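/- Consider the Holling--Tanner model with a discrete delay $$u_t-d_1u_{xx}=u(1-u)-\frac{auv}{u+b},\qquad v_t-d_2v_{xx}=rv\Bigl(1-\frac{v(x,t-\tau)}{u(x,t-\tau)}\Bigr),\qquad x\in(0,l\pi),\ t>0,$$ with $u_x=v_x=0$ at $x=0,l\pi$, and with $d_1=0.1$, $d_2=10$, $a=1$, $b=0.1$, $l=5$; the bifurcation parameters are $(\tau,r)$. For every $\tau$ and every $r>0$ it has exactly one constant steady state $E_1$ with positive components; $E_1$ does not depend on $(\tau,r)$, and $E_1=(0.270,0.270)$ up to rounding. Let $D=\mathrm{diag}(d_1,d_2)$ and let $A$, $B$ be the Jacobian matrices at $E_1$ of the right-hand sides with respect to $(u(t),v(t))$ and to $(u(t-\tau),v(t-\tau))$. An eigenvalue of the linearization $U'(t)=DU_{xx}(t)+AU(t)+BU(t-\tau)$ is a $\lambda\in\mathbb C$ such that $\lambda y-Dy''-Ay-e^{-\lambda\tau}By=0$ for some nonzero $y\in H^2((0,l\pi);\mathbb C^2)$ with $y'=0$ at $0$ and $l\pi$; it is of mode $n$ if $\det\bigl[\lambda I+\frac{n^2}{l^2}D-A-e^{-\lambda\tau}B\bigr]=0$.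 It is simple if its algebraic multiplicity is one: the solutions $y$ form a one-dimensional space and, for a nonzero such $y$, no function $e^{\lambda t}(ty+w)$ with $w\in H^2((0,l\pi);\mathbb C^2)$, $w'=0$ at $0$ and $l\pi$, solves the linearization. There are real numbers $\tau_0,r_0,\omega_0$ which, rounded to four decimals, are $\tau_0=0.4567$, $r_0=2.8646$, $\omega_0=2.8899$ (each within $5\cdot10^{-5}$ of the stated value), such that: (i) For $(\tau,r)=(\tau_0,r_0)$ the linearization at $E_1$ has the eigenvalues $\pm i\omega_0$, of mode $0$, and the eigenvalue $0$, of mode $5$; all its other eigenvalues have strictly negative real part. (ii) At $(\tau_0,r_0)$ the model undergoes a Turing--Hopf bifurcation from $E_1$, in the following sense: for $(\tau,r)$ in some neighbourhood $O$ of $(\tau_0,r_0)$ the linearization at $E_1$ has a pair of simple complex conjugate eigenvalues $\alpha(\tau,r)\pm i\omega(\tau,r)$ of mode $0$ and a simple real eigenvalue $\gamma(\tau,r)$ of mode $5$, where $\alpha,\omega,\gamma$ are continuously differentiable, $\alpha(\tau_0,r_0)=\gamma(\tau_0,r_0)=0$, $\omega(\tau_0,r_0)=\omega_0>0$, $\frac{\partial\alpha}{\partial\tau}(\tau_0,r_0)\ne0$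 and $\frac{\partial\gamma}{\partial r}(\tau_0,r_0)\ne0$; and for $(\tau,r)\in O$ all other eigenvalues have nonzero real part. -/

import Mathlib

open MeasureTheory Set

/-- The data of a two-component reaction-diffusion system with one discrete delay `τ`,
`u_t - d₁ u_xx = f(u(t), v(t), u(t - τ), v(t - τ))`,
`v_t - d₂ v_xx = g(u(t), v(t), u(t - τ), v(t - τ))` on `(0, lπ)`,
with homogeneous Neumann boundary conditions. -/
structure DelayedRDSystem where
  l : ℝ
  d₁ : ℝ
  d₂ : ℝ
  τ : ℝ
  f : ℝ → ℝ → ℝ → ℝ → ℝ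
  g : ℝ → ℝ → ℝ → ℝ → ℝ

namespace DelayedRDSystem

variable (S : DelayedRDSystem)

/-- `(u, v)` is a constant steady state. -/
def IsSteadyState (E : ℝ × ℝ) : Prop :=
  S.f E.1 E.2 E.1 E.2 = 0 ∧ S.g E.1 E.2 E.1 E.2 = 0

/-- The diffusion matrix `diag(d₁, d₂)`. -/
noncomputable def D : Matrix (Fin 2) (Fin 2) ℂ :=
  !![(S.d₁ : ℂ), 0; 0, (S.d₂ : ℂ)]

/-- Jacobian matrix, at the constant state `E`, of the reaction terms with respect to the
non-delayed variables `u(t), v(t)`. -/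
noncomputable def A (E : ℝ × ℝ) : Matrix (Fin 2) (Fin 2) ℂ :=
  !![((deriv (fun s => S.f s E.2 E.1 E.2) E.1 : ℝ) : ℂ),
     ((deriv (fun s => S.f E.1 s E.1 E.2) E.2 : ℝ) : ℂ);
     ((deriv (fun s => S.g s E.2 E.1 E.2) E.1 : ℝ) : ℂ),
     ((deriv (fun s => S.g E.1 s E.1 E.2) E.2 : ℝ) : ℂ)]

/-- Jacobian matrix, at the constant state `E`, of the reaction terms with respect to the
delayed variables `u(t - τ), v(t - τ)`. -/
noncomputable def B (E : ℝ × ℝ) : Matrix (Fin 2) (Fin 2) ℂ :=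
  !![((deriv (fun s => S.f E.1 E.2 s E.2) E.1 : ℝ) : ℂ),
     ((deriv (fun s => S.f E.1 E.2 E.1 s) E.2 : ℝ) : ℂ);
     ((deriv (fun s => S.g E.1 E.2 s E.2) E.1 : ℝ) : ℂ),
     ((deriv (fun s => S.g E.1 E.2 E.1 s) E.2 : ℝ) : ℂ)]

/-- `y` (restricted to `[0, L]`) belongs to `H²(0, L)`, with first derivative `y₁` and weak
second derivative `y₂`, and satisfies the Neumann condition at both ends: `y` is `C¹`, `y₁` is
a primitive of `y₂ ∈ L²`, and `y₁` vanishes at `0` and at `L`. -/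
structure IsNeumannH2 (L : ℝ) (y y₁ y₂ : ℝ → Fin 2 → ℂ) : Prop where
  hasDeriv : ∀ x ∈ Icc 0 L, HasDerivWithinAt y (y₁ x) (Icc 0 L) x
  memLp : MemLp y₂ 2 (volume.restrict (Ioo 0 L))
  primitive : ∀ x ∈ Icc 0 L, y₁ x = y₁ 0 + ∫ t in (0 : ℝ)..x, y₂ t
  left : y₁ 0 = 0
  right : y₁ L = 0

/-- `y` lies in the domain of the Neumann Laplacian and
`z y - D y'' - A y - e^{-zτ} B y = h` almost everywhere on `(0, lπ)`. The left-hand side is the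
characteristic operator at `z` of the linearization
`U'(t) = D U_xx(t) + A U(t) + B U(t - τ)` at the constant state `E`. -/
def CharEq (E : ℝ × ℝ) (z : ℂ) (y h : ℝ → Fin 2 → ℂ) : Prop :=
  ∃ y₁ y₂ : ℝ → Fin 2 → ℂ, IsNeumannH2 (S.l * Real.pi) y y₁ y₂ ∧
    ∀ᵐ x ∂(volume.restrict (Ioo 0 (S.l * Real.pi))),
      z • y x - (S.D).mulVec (y₂ x) - (S.A E).mulVec (y x)
        - Complex.exp (-z * S.τ) • (S.B E).mulVec (y x) = h x

/-- `y` is a characteristic vector for `z`: a nonzero solution of the characteristic equation. -/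
def IsCharVector (E : ℝ × ℝ) (z : ℂ) (y : ℝ → Fin 2 → ℂ) : Prop :=
  (∃ x ∈ Icc 0 (S.l * Real.pi), y x ≠ 0) ∧ S.CharEq E z y 0

/-- `z` is an eigenvalue (characteristic value) of the linearization at `E`. -/
def IsCharValue (E : ℝ × ℝ) (z : ℂ) : Prop :=
  ∃ y, S.IsCharVector E z y

/-- `z` is an eigenvalue of mode `n`: a root of
`det (z I + (n² / l²) D - A - e^{-zτ} B) = 0`. -/
def IsCharValueOfMode (E : ℝ × ℝ) (n : ℕ) (z : ℂ) : Prop :=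
  (z • (1 : Matrix (Fin 2) (Fin 2) ℂ) + ((n : ℂ) ^ 2 / (S.l : ℂ) ^ 2) • S.D - S.A E
    - Complex.exp (-z * S.τ) • S.B E).det = 0

/-- `z` is a simple eigenvalue (algebraic multiplicity one): the characteristic vectors are the
nonzero multiples of one `y`, and there is no Jordan chain over `y`, that is, no `w` such that
`e^{zt} (t y + w)` solves the linearized equation. Substituting, the latter means that the
characteristic operator at `z` sends `w` to `-(y + τ e^{-zτ} B y)`. -/
def IsSimpleCharValue (E : ℝ × ℝ) (z : ℂ) : Prop :=
  ∃ y, S.IsCharVector E z y ∧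
    (∀ y', S.CharEq E z y' 0 →
      ∃ c : ℂ, ∀ x ∈ Icc 0 (S.l * Real.pi), y' x = c • y x) ∧
    ¬ ∃ w, S.CharEq E z w
      (fun x => -(y x + ((S.τ : ℂ) * Complex.exp (-z * S.τ)) • (S.B E).mulVec (y x)))

end DelayedRDSystem

/-- The family `F` of systems undergoes a Turing-Hopf bifurcation at `μ₀` from the constant steady
state `E`, with frequency `ω₀` and Turing mode `n₂`: for all `μ` near `μ₀`, `E` is a steady state,
its linearization has a pair of simple complex conjugate eigenvalues `α(μ) ± i ω(μ)` of mode `0`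
and a simple real eigenvalue `γ(μ)` of mode `n₂ ≠ 0`, all continuously differentiable in `μ`, and
no other eigenvalue lies on the imaginary axis; at `μ₀` these are `± i ω₀ ≠ 0` and `0`, and
`∂α/∂μ₁ (μ₀) ≠ 0`, `∂γ/∂μ₂ (μ₀) ≠ 0`. -/
def UndergoesTuringHopf (F : ℝ × ℝ → DelayedRDSystem) (E μ₀ : ℝ × ℝ) (ω₀ : ℝ) (n₂ : ℕ) : Prop :=
  n₂ ≠ 0 ∧ 0 < ω₀ ∧
  ∃ O : Set (ℝ × ℝ), IsOpen O ∧ μ₀ ∈ O ∧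
    ∃ α ω γ : ℝ × ℝ → ℝ,
      ContDiffOn ℝ 1 α O ∧ ContDiffOn ℝ 1 ω O ∧ ContDiffOn ℝ 1 γ O ∧
      (∀ μ ∈ O,
        (F μ).IsSteadyState E ∧
        (F μ).IsCharValueOfMode E 0 (α μ + ω μ * Complex.I) ∧
        (F μ).IsSimpleCharValue E (α μ + ω μ * Complex.I) ∧
        (F μ).IsCharValueOfMode E 0 (α μ - ω μ * Complex.I) ∧
        (F μ).IsSimpleCharValue E (α μ - ω μ * Complex.I) ∧
        (F μ).IsCharValueOfMode E n₂ (γ μ) ∧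
        (F μ).IsSimpleCharValue E (γ μ) ∧
        ∀ z : ℂ, (F μ).IsCharValue E z →
          z ≠ α μ + ω μ * Complex.I → z ≠ α μ - ω μ * Complex.I → z ≠ γ μ → z.re ≠ 0) ∧
      α μ₀ = 0 ∧ ω μ₀ = ω₀ ∧ γ μ₀ = 0 ∧
      deriv (fun s => α (s, μ₀.2)) μ₀.1 ≠ 0 ∧
      deriv (fun s => γ (μ₀.1, s)) μ₀.2 ≠ 0

/-- The diffusive Holling-Tanner model with a discrete delay `τ`:
`u_t - d₁ u_xx = u (1 - u) - a u v / (u + b)`,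
`v_t - d₂ v_xx = r v (1 - v(t - τ) / u(t - τ))` on `(0, lπ)`, Neumann boundary conditions. -/
noncomputable def hollingTanner (d₁ d₂ a b l τ r : ℝ) : DelayedRDSystem where
  l := l
  d₁ := d₁
  d₂ := d₂
  τ := τ
  f := fun u v _ _ => u * (1 - u) - a * u * v / (u + b)
  g := fun _ v uτ vτ => r * v * (1 - vτ / uτ)

/-- The delayed Holling-Tanner model with `d₁ = 0.1`, `d₂ = 10`, `a = 1`, `b = 0.1`, `l = 5`, as a
family in the two parameters `μ = (τ, r)`. -/
noncomputable def hollingTannerFamily (μ : ℝ × ℝ) : DelayedRDSystem :=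
  hollingTanner 0.1 10 1 0.1 5 μ.1 μ.2

/-!
The Neumann problem on `(0, lπ)` is diagonalized by the cosines `cos (n x / l)`. Integrating the
characteristic equation against them (`CharEq.charMatrix_mulVec_cosCoeff`) and using their
completeness (`eq_zero_of_cosCoeff_eq_zero`) turns eigenvalues and their simplicity into statements
about the `2 × 2` characteristic matrices of the modes: an eigenvalue is a root, for some `n`, of
`(z + c) (z + d) + r e^{-zτ} (z + c + β)` with `c = n² / 250 - jacUU`, `d = 2 n² / 5`, `β = jacUV`,
and it is simple when it is a simple root for one mode and no root for the others.

The heart of the proof is the location of these roots in the closed right half-plane. In the upper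
half-plane the equation reads `F z = log r + iπ`, where `F z = τ z + log (z + c) + log (z + d) -
log (z + c + β)`. For `Re z ≥ 0` the derivative of `F` has negative imaginary part, so the
difference quotients of `F` do, too (the Noshiro-Warschawski argument, `charLog_slope_im_neg`).
Compare a root `z` with the point `iω` at which the modulus condition `Re F = log r` holds. If the
phase `Im F (iω)` is below `π`, then `z` must lie in the left half-plane; if it equals `π`, then
`z = iω` (`eq_of_charFn_eq_zero`). The critical delay is chosen so that the phase of mode `0` is
exactly `π`; for the modes `1`, `2`, `3` it is smaller. For the higher modes the damping `d`
exceeds `r` so much that roots in the right half-plane are real (`im_eq_zero_of_charFn_eq_zero`),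
and real roots are governed by the sign of the characteristic function at `0`: with `k = n² / 25`
it is close to `(k - 1) (k - 1.34)`, which is positive unless `n = 5`, and the critical `r` makes
it vanish for `n = 5`. All strict estimates hold uniformly on the neighbourhood `paramBox` of the
critical parameters.

The implicit function theorem continues the simple roots `iω₀` and `0` to `C¹` branches that are
the only roots nearby. Imaginary roots for nearby parameters are close to these two (for mode `0`
because the modulus condition is a quadratic equation in `ω²`), hence lie on the branches. Along the
Hopf branch `dz/dτ = -z / F' z`, whose real part is nonzero since `F' (iω₀)` is not real; along the
Turing branch the derivative with respect to `r` is explicit.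
-/

/-! ### Cosine series on `(0, lπ)` -/

/-- The `n`-th Neumann eigenfunction `cos (n x / l)` of the interval `(0, lπ)`. -/
noncomputable def neumannMode (l : ℝ) (n : ℕ) (x : ℝ) : ℝ := Real.cos (n / l * x)

/-- The (unnormalized) `n`-th cosine coefficient of a complex function on `(0, lπ)`. -/
noncomputable def cosCoeff (l : ℝ) (n : ℕ) (f : ℝ → ℂ) : ℂ :=
  ∫ x in (0 : ℝ)..(l * Real.pi), (neumannMode l n x : ℂ) * f x

lemma hasDerivAt_neumannMode (l : ℝ) (n : ℕ) (x : ℝ) :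
    HasDerivAt (neumannMode l n) (-(n / l) * Real.sin (n / l * x)) x := by
  have := ((hasDerivAt_id x).const_mul ((n : ℝ) / l)).cos
  simp only [id, mul_one] at this
  exact this.congr_deriv (by ring)

lemma contDiff_neumannMode (l : ℝ) (n : ℕ) : ContDiff ℝ 1 (neumannMode l n) := by
  unfold neumannMode; fun_prop

@[fun_prop]
lemma continuous_neumannMode (l : ℝ) (n : ℕ) : Continuous (neumannMode l n) :=
  (contDiff_neumannMode l n).continuous

/-- Integration by parts against a `C¹` function for a primitive of an integrable function that
vanishes at both endpoints. -/
lemma integral_mul_eq_neg_of_primitive {L : ℝ} (hL : 0 ≤ L) {p q g : ℝ → ℝ}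
    (hq : IntervalIntegrable q volume 0 L) (hp : ∀ x ∈ Icc 0 L, p x = ∫ t in (0 : ℝ)..x, q t)
    (hpL : p L = 0) (hg : ContDiff ℝ 1 g) :
    ∫ x in (0 : ℝ)..L, g x * q x = -∫ x in (0 : ℝ)..L, deriv g x * p x := by
  set P : ℝ → ℝ := fun x => ∫ t in (0 : ℝ)..x, q t with hP
  have hPac : AbsolutelyContinuousOnInterval P 0 L :=
    hq.absolutelyContinuousOnInterval_intervalIntegral (by simp)
  have hgac : AbsolutelyContinuousOnInterval g 0 L := hg.contDiffOn.absolutelyContinuousOnInterval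
  have h := hPac.integral_deriv_mul_eq_sub hgac
  have hPL : P L = 0 := by rw [← hpL, hp L ⟨hL, le_rfl⟩]
  have hP0 : P 0 = 0 := by simp [hP]
  rw [hPL, hP0, zero_mul, zero_mul, sub_zero] at h
  have hae : ∀ᵐ x, x ∈ uIoc 0 L →
      deriv P x * g x + P x * deriv g x = g x * q x + deriv g x * p x := by
    filter_upwards [hq.ae_hasDerivAt_integral] with x hx hxL
    have hxI : x ∈ uIcc 0 L := uIoc_subset_uIcc hxL
    have h1 := (hx hxI 0 (by simp)).deriv
    rw [hP] at *
    rw [h1, hp x (by rwa [uIcc_of_le hL] at hxI)]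
    ring
  rw [intervalIntegral.integral_congr_ae hae, intervalIntegral.integral_add] at h
  · linarith
  · exact hq.continuousOn_mul hg.continuous.continuousOn
  · refine ContinuousOn.intervalIntegrable ?_
    refine (hg.continuous_deriv le_rfl).continuousOn.mul (hPac.continuousOn.congr ?_)
    intro x hx
    exact hp x (by rwa [uIcc_of_le hL] at hx)

/-- `integral_mul_eq_neg_of_primitive` for complex-valued primitives. -/
lemma integral_ofReal_mul_eq_neg_of_primitive {L : ℝ} (hL : 0 ≤ L) {p q : ℝ → ℂ} {g : ℝ → ℝ}
    (hq : IntervalIntegrable q volume 0 L) (hp : ∀ x ∈ Icc 0 L, p x = ∫ t in (0 : ℝ)..x, q t)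
    (hpL : p L = 0) (hg : ContDiff ℝ 1 g) :
    ∫ x in (0 : ℝ)..L, (g x : ℂ) * q x = -∫ x in (0 : ℝ)..L, ((deriv g x : ℝ) : ℂ) * p x := by
  have hqL (x) (hx : x ∈ Icc 0 L) : IntervalIntegrable q volume 0 x :=
    hq.mono_set (uIcc_subset_uIcc (by simp) (by rwa [uIcc_of_le hL]))
  have hpc : ContinuousOn p (uIcc 0 L) :=
    (intervalIntegral.continuousOn_primitive_interval' hq (by simp)).congr
      (fun x hx => hp x (by rwa [uIcc_of_le hL] at hx))
  have hgq : IntervalIntegrable (fun x => (g x : ℂ) * q x) volume 0 L :=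
    hq.continuousOn_mul (Complex.continuous_ofReal.comp hg.continuous).continuousOn
  have hgp : IntervalIntegrable (fun x => ((deriv g x : ℝ) : ℂ) * p x) volume 0 L :=
    ((Complex.continuous_ofReal.comp (hg.continuous_deriv le_rfl)).continuousOn.mul
      hpc).intervalIntegrable
  have key : ∀ φ : ℂ →L[ℝ] ℝ, φ (∫ x in (0 : ℝ)..L, (g x : ℂ) * q x)
      = φ (-∫ x in (0 : ℝ)..L, ((deriv g x : ℝ) : ℂ) * p x) := by
    intro φ
    have hmul : ∀ (a : ℝ) (w : ℂ), φ ((a : ℂ) * w) = a * φ w := fun a w => by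
      rw [← Complex.real_smul, map_smul, smul_eq_mul]
    rw [map_neg, ← φ.intervalIntegral_comp_comm hgq, ← φ.intervalIntegral_comp_comm hgp]
    simp only [hmul]
    refine integral_mul_eq_neg_of_primitive hL ⟨φ.integrable_comp hq.1, φ.integrable_comp hq.2⟩
      (fun x hx => ?_) (by simp [hpL]) hg
    rw [hp x hx, φ.intervalIntegral_comp_comm (hqL x hx)]
  exact Complex.ext (key Complex.reCLM) (key Complex.imCLM)

/-- The Neumann Laplacian acts on cosine coefficients as multiplication by `-(n / l)²`. -/
lemma cosCoeff_second_deriv {l : ℝ} (hl : 0 < l) (n : ℕ) {y y₁ y₂ : ℝ → Fin 2 → ℂ}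
    (h : DelayedRDSystem.IsNeumannH2 (l * Real.pi) y y₁ y₂) (i : Fin 2) :
    cosCoeff l n (fun x => y₂ x i) = -(n / l : ℂ) ^ 2 * cosCoeff l n (fun x => y x i) := by
  have hL : 0 ≤ l * Real.pi := by positivity
  have hint : IntervalIntegrable y₂ volume 0 (l * Real.pi) := by
    rw [intervalIntegrable_iff_integrableOn_Ioo_of_le hL]
    exact h.memLp.integrable (by norm_num)
  have hi : IntervalIntegrable (fun x => y₂ x i) volume 0 (l * Real.pi) := by
    rw [intervalIntegrable_iff_integrableOn_Ioo_of_le hL] at hint ⊢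
    exact hint.eval i
  have hprim : ∀ x ∈ Icc 0 (l * Real.pi), y₁ x i = ∫ t in (0 : ℝ)..x, y₂ t i := by
    intro x hx
    have h1 := h.primitive x hx
    rw [h.left, zero_add] at h1
    rw [h1]
    have hx' : IntervalIntegrable y₂ volume 0 x :=
      hint.mono_set (uIcc_subset_uIcc (by simp) (by rwa [uIcc_of_le hL]))
    exact ((ContinuousLinearMap.proj (R := ℝ) (φ := fun _ : Fin 2 => ℂ)
      i).intervalIntegral_comp_comm hx').symm
  have hd : ∀ x ∈ Icc 0 (l * Real.pi),
      HasDerivWithinAt (fun t => y t i) (y₁ x i) (Icc 0 (l * Real.pi)) x := fun x hx =>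
    (hasDerivWithinAt_pi.1 (h.hasDeriv x hx)) i
  have h1 := integral_ofReal_mul_eq_neg_of_primitive hL hi hprim (by simp [h.right])
    (contDiff_neumannMode l n)
  have hs : ∀ x : ℝ, HasDerivAt (fun x : ℝ => ((Real.sin (n / l * x) : ℝ) : ℂ))
      ((n / l : ℂ) * (neumannMode l n x : ℂ)) x := by
    intro x
    have := (((hasDerivAt_id x).const_mul ((n : ℝ) / l)).sin).ofReal_comp
    refine this.congr_deriv ?_
    simp only [neumannMode, id]
    push_cast
    ring
  have hy₁c : ContinuousOn (fun x => y₁ x i) (uIcc 0 (l * Real.pi)) :=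
    (intervalIntegral.continuousOn_primitive_interval' hi (by simp)).congr
      (fun x hx => hprim x (by rwa [uIcc_of_le hL] at hx))
  have h2 := intervalIntegral.integral_mul_deriv_eq_deriv_mul_of_hasDerivWithinAt
    (a := 0) (b := l * Real.pi)
    (u := fun x : ℝ => ((Real.sin (n / l * x) : ℝ) : ℂ)) (v := fun x => y x i)
    (u' := fun x => (n / l : ℂ) * (neumannMode l n x : ℂ)) (v' := fun x => y₁ x i)
    (fun x _ => (hs x).hasDerivWithinAt)
    (fun x hx => by rw [uIcc_of_le hL] at hx ⊢; exact hd x hx)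
    (by apply Continuous.intervalIntegrable; fun_prop) hy₁c.intervalIntegrable
  have hsin : Real.sin (n / l * (l * Real.pi)) = 0 := by
    rw [← mul_assoc, div_mul_cancel₀ _ hl.ne', Real.sin_nat_mul_pi]
  rw [hsin] at h2
  simp only [mul_zero, Real.sin_zero, Complex.ofReal_zero, zero_mul, sub_zero, zero_sub] at h2
  unfold cosCoeff
  rw [h1]
  have h3 : ∀ x, ((deriv (neumannMode l n) x : ℝ) : ℂ) * y₁ x i
      = -(n / l : ℂ) * (((Real.sin (n / l * x) : ℝ) : ℂ) * y₁ x i) := by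
    intro x
    rw [(hasDerivAt_neumannMode l n x).deriv]
    push_cast
    ring
  simp only [h3]
  rw [intervalIntegral.integral_const_mul, h2]
  simp only [mul_assoc]
  rw [intervalIntegral.integral_const_mul]
  ring

/-- Orthogonality to all cosines passes to their products with powers of `cos (x / l)`, as
`2 cos a cos b = cos (a + b) + cos (a - b)`. -/
lemma integral_cos_pow_mul_neumannMode {l : ℝ} {f : ℝ → ℝ}
    (hf : ContinuousOn f (uIcc 0 (l * Real.pi)))
    (h : ∀ n, ∫ x in (0 : ℝ)..(l * Real.pi), neumannMode l n x * f x = 0) (k : ℕ) :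
    ∀ n, ∫ x in (0 : ℝ)..(l * Real.pi), neumannMode l 1 x ^ k * (neumannMode l n x * f x) = 0 := by
  induction k with
  | zero => simpa using h
  | succ k ih =>
    have hint : ∀ n, IntervalIntegrable
        (fun x => neumannMode l 1 x ^ k * (neumannMode l n x * f x)) volume 0 (l * Real.pi) :=
      fun n =>
        (ContinuousOn.mul (by fun_prop) (ContinuousOn.mul (by fun_prop) hf)).intervalIntegrable
    rintro (_ | n)
    · convert ih 1 using 3 with x
      simp [neumannMode, pow_succ]
      ring
    · have h2 : ∀ x, neumannMode l 1 x ^ (k + 1) * (neumannMode l (n + 1) x * f x)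
          = 1 / 2 * (neumannMode l 1 x ^ k * (neumannMode l (n + 2) x * f x)
            + neumannMode l 1 x ^ k * (neumannMode l n x * f x)) := by
        intro x
        have h3 : neumannMode l (n + 2) x + neumannMode l n x
            = 2 * neumannMode l 1 x * neumannMode l (n + 1) x := by
          simp only [neumannMode]
          have e1 : ((n + 2 : ℕ) : ℝ) / l * x
              = ((n + 1 : ℕ) : ℝ) / l * x + ((1 : ℕ) : ℝ) / l * x := by
            push_cast; ring
          have e2 : (n : ℝ) / l * x = ((n + 1 : ℕ) : ℝ) / l * x - ((1 : ℕ) : ℝ) / l * x := by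
            push_cast; ring
          rw [e1, e2, Real.cos_add, Real.cos_sub]
          ring
        rw [pow_succ]
        linear_combination (-1 / 2 * neumannMode l 1 x ^ k * f x) * h3
      simp only [h2]
      rw [intervalIntegral.integral_const_mul, intervalIntegral.integral_add (hint _) (hint _),
        ih, ih]
      simp

/-- Completeness of the cosines: by the Weierstrass theorem a continuous function on `[0, lπ]` is a
uniform limit of polynomials in `cos (x / l)`, to which it is orthogonal. -/
lemma eq_zero_of_integral_neumannMode_eq_zero {l : ℝ} (hl : 0 < l) {f : ℝ → ℝ}
    (hf : ContinuousOn f (Icc 0 (l * Real.pi)))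
    (h : ∀ n, ∫ x in (0 : ℝ)..(l * Real.pi), neumannMode l n x * f x = 0) :
    ∀ x ∈ Icc 0 (l * Real.pi), f x = 0 := by
  have hL : 0 < l * Real.pi := by positivity
  have hf' : ContinuousOn f (uIcc 0 (l * Real.pi)) := by rwa [uIcc_of_le hL.le]
  have hpoly : ∀ p : Polynomial ℝ,
      ∫ x in (0 : ℝ)..(l * Real.pi), p.eval (neumannMode l 1 x) * f x = 0 := by
    intro p
    simp only [Polynomial.eval_eq_sum_range, Finset.sum_mul]
    rw [intervalIntegral.integral_finsetSum]
    · refine Finset.sum_eq_zero fun i _ => ?_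
      simp only [mul_assoc]
      rw [intervalIntegral.integral_const_mul]
      have := integral_cos_pow_mul_neumannMode hf' h i 0
      simp only [neumannMode, CharP.cast_eq_zero, zero_div, zero_mul, Real.cos_zero,
        one_mul] at this ⊢
      rw [this, mul_zero]
    · intro i _
      exact (ContinuousOn.mul (by fun_prop) hf').intervalIntegrable
  set M := ∫ x in (0 : ℝ)..(l * Real.pi), |f x| with hM
  have hM0 : 0 ≤ M := intervalIntegral.integral_nonneg hL.le fun x _ => abs_nonneg _
  have hsq : ∫ x in (0 : ℝ)..(l * Real.pi), f x * f x ≤ 0 := by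
    refine le_of_forall_pos_le_add fun ε hε => ?_
    rw [zero_add]
    set g : ℝ → ℝ := fun t => f (l * Real.arccos t)
    have hg : ContinuousOn g (Icc (-1) 1) := by
      refine hf.comp (by fun_prop) fun t _ => ⟨by have := Real.arccos_nonneg t; positivity, ?_⟩
      exact mul_le_mul_of_nonneg_left (Real.arccos_le_pi t) hl.le
    obtain ⟨p, hp⟩ :=
      exists_polynomial_near_of_continuousOn (-1) 1 g hg (ε / (M + 1)) (by positivity)
    have hp' : ∀ x ∈ Icc 0 (l * Real.pi), |p.eval (neumannMode l 1 x) - f x| ≤ ε / (M + 1) := by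
      intro x hx
      have h1 := hp (neumannMode l 1 x) ⟨Real.neg_one_le_cos _, Real.cos_le_one _⟩
      have h2 : l * Real.arccos (neumannMode l 1 x) = x := by
        unfold neumannMode
        rw [Real.arccos_cos]
        · field_simp; simp
        · have := hx.1; positivity
        · have := hx.2
          rw [Nat.cast_one, one_div_mul_eq_div, div_le_iff₀ hl]
          linarith
      simp only [g, h2] at h1
      exact h1.le
    have hpi : IntervalIntegrable (fun x => p.eval (neumannMode l 1 x) * f x) volume 0
        (l * Real.pi) := by
      refine (ContinuousOn.mul (Continuous.continuousOn ?_) hf').intervalIntegrable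
      exact p.continuous.comp (continuous_neumannMode l 1)
    have hff : IntervalIntegrable (fun x => f x * f x) volume 0 (l * Real.pi) :=
      (hf'.mul hf').intervalIntegrable
    calc ∫ x in (0 : ℝ)..(l * Real.pi), f x * f x
        = ∫ x in (0 : ℝ)..(l * Real.pi), (f x * f x - p.eval (neumannMode l 1 x) * f x) := by
          rw [intervalIntegral.integral_sub hff hpi, hpoly, sub_zero]
      _ ≤ ∫ x in (0 : ℝ)..(l * Real.pi), ε / (M + 1) * |f x| := by
          refine intervalIntegral.integral_mono_on hL.le
            (hff.sub hpi)
            (ContinuousOn.intervalIntegrable (continuousOn_const.mul hf'.abs)) fun x hx => ?_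
          calc _ = (f x - p.eval (neumannMode l 1 x)) * f x := by ring
            _ ≤ |(f x - p.eval (neumannMode l 1 x)) * f x| := le_abs_self _
            _ = |p.eval (neumannMode l 1 x) - f x| * |f x| := by rw [abs_mul, abs_sub_comm]
            _ ≤ _ := mul_le_mul_of_nonneg_right (hp' x hx) (abs_nonneg _)
      _ = ε / (M + 1) * M := by rw [intervalIntegral.integral_const_mul]
      _ ≤ ε := by
          rw [div_mul_eq_mul_div, div_le_iff₀ (by positivity)]
          nlinarith
  intro x hx
  by_contra hne
  refine absurd (intervalIntegral.integral_pos hL (hf.mul hf)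
    (fun x _ => mul_self_nonneg (f x)) ⟨x, hx, ?_⟩) (not_lt.2 hsq)
  exact mul_self_pos.2 hne

lemma eq_zero_of_cosCoeff_eq_zero {l : ℝ} (hl : 0 < l) {f : ℝ → ℂ}
    (hf : ContinuousOn f (Icc 0 (l * Real.pi))) (h : ∀ n, cosCoeff l n f = 0) :
    ∀ x ∈ Icc 0 (l * Real.pi), f x = 0 := by
  have hL : 0 ≤ l * Real.pi := by positivity
  have hint : ∀ n, IntervalIntegrable (fun x => (neumannMode l n x : ℂ) * f x) volume 0
      (l * Real.pi) := fun n =>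
    (ContinuousOn.mul (by fun_prop) (by rwa [uIcc_of_le hL])).intervalIntegrable
  have hre := eq_zero_of_integral_neumannMode_eq_zero hl (f := fun x => (f x).re)
    (Complex.continuous_re.comp_continuousOn hf) fun n => by
      have := Complex.reCLM.intervalIntegral_comp_comm (hint n)
      simp only [Complex.reCLM_apply, Complex.re_ofReal_mul] at this
      rw [this]
      exact congrArg Complex.re (h n)
  have him := eq_zero_of_integral_neumannMode_eq_zero hl (f := fun x => (f x).im)
    (Complex.continuous_im.comp_continuousOn hf) fun n => by
      have := Complex.imCLM.intervalIntegral_comp_comm (hint n)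
      simp only [Complex.imCLM_apply, Complex.im_ofReal_mul] at this
      rw [this]
      exact congrArg Complex.im (h n)
  exact fun x hx => Complex.ext (hre x hx) (him x hx)

lemma cosCoeff_neumannMode_ne_zero {l : ℝ} (hl : 0 < l) (n : ℕ) :
    cosCoeff l n (fun x => (neumannMode l n x : ℂ)) ≠ 0 := by
  have hL : 0 < l * Real.pi := by positivity
  have h1 : cosCoeff l n (fun x => (neumannMode l n x : ℂ))
      = ((∫ x in (0 : ℝ)..(l * Real.pi), neumannMode l n x * neumannMode l n x : ℝ) : ℂ) := by
    rw [cosCoeff, ← intervalIntegral.integral_ofReal]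
    push_cast
    rfl
  rw [h1, Complex.ofReal_ne_zero]
  refine (intervalIntegral.integral_pos hL (by fun_prop) (fun x _ => mul_self_nonneg _)
    ⟨0, ⟨le_rfl, hL.le⟩, ?_⟩).ne'
  simp [neumannMode]

/-! ### Reduction of the spectrum to the modes -/

namespace DelayedRDSystem

variable (S : DelayedRDSystem)

/-- The characteristic matrix of mode `n`: the characteristic operator at `z` acting on
`cos (n x / l) • v`. -/
noncomputable def charMatrix (E : ℝ × ℝ) (n : ℕ) (z : ℂ) : Matrix (Fin 2) (Fin 2) ℂ :=
  z • (1 : Matrix (Fin 2) (Fin 2) ℂ) + ((n : ℂ) ^ 2 / (S.l : ℂ) ^ 2) • S.D - S.A E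
    - Complex.exp (-z * S.τ) • S.B E

variable {S} {E : ℝ × ℝ} {z : ℂ}

lemma isCharValueOfMode_iff_det {n : ℕ} :
    S.IsCharValueOfMode E n z ↔ (S.charMatrix E n z).det = 0 := Iff.rfl

lemma IsNeumannH2.continuousOn {L : ℝ} {y y₁ y₂ : ℝ → Fin 2 → ℂ} (h : IsNeumannH2 L y y₁ y₂) :
    ContinuousOn y (Icc 0 L) := fun x hx => (h.hasDeriv x hx).continuousWithinAt

lemma CharEq.continuousOn {y h : ℝ → Fin 2 → ℂ} (H : S.CharEq E z y h) :
    ContinuousOn y (Icc 0 (S.l * Real.pi)) := by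
  obtain ⟨y₁, y₂, hy, -⟩ := H
  exact hy.continuousOn

/-- The characteristic operator is diagonalized by the cosines: it acts on the `n`-th cosine
coefficients through the characteristic matrix of mode `n`. -/
lemma CharEq.charMatrix_mulVec_cosCoeff (hl : 0 < S.l) {y h : ℝ → Fin 2 → ℂ}
    (H : S.CharEq E z y h) (n : ℕ) :
    (S.charMatrix E n z).mulVec (fun i => cosCoeff S.l n (fun x => y x i))
      = fun i => cosCoeff S.l n (fun x => h x i) := by
  obtain ⟨y₁, y₂, hy, heq⟩ := H
  have hL : 0 ≤ S.l * Real.pi := by positivity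
  have hyi : ∀ i, IntervalIntegrable (fun x => (neumannMode S.l n x : ℂ) * y x i) volume 0
      (S.l * Real.pi) := fun i => by
    refine (ContinuousOn.mul (by fun_prop) ?_).intervalIntegrable
    rw [uIcc_of_le hL]
    exact continuousOn_pi.1 hy.continuousOn i
  have hy2i : ∀ i, IntervalIntegrable (fun x => (neumannMode S.l n x : ℂ) * y₂ x i) volume 0
      (S.l * Real.pi) := fun i => by
    have : IntervalIntegrable (fun x => y₂ x i) volume 0 (S.l * Real.pi) := by
      rw [intervalIntegrable_iff_integrableOn_Ioo_of_le hL]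
      exact (hy.memLp.integrable (by norm_num)).eval i
    exact this.continuousOn_mul (by fun_prop)
  have h2 := fun i => cosCoeff_second_deriv hl n hy i
  have hae : ∀ i, cosCoeff S.l n (fun x => h x i)
      = ∫ x in (0 : ℝ)..(S.l * Real.pi), (∑ j, (z • (1 : Matrix (Fin 2) (Fin 2) ℂ) - S.A E
          - Complex.exp (-z * S.τ) • S.B E) i j * ((neumannMode S.l n x : ℂ) * y x j)
          - ∑ j, S.D i j * ((neumannMode S.l n x : ℂ) * y₂ x j)) := by
    intro i
    unfold cosCoeff
    refine intervalIntegral.integral_congr_ae ?_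
    rw [uIoc_of_le hL, ← ae_restrict_iff' measurableSet_Ioc,
      ← Measure.restrict_congr_set Ioo_ae_eq_Ioc]
    filter_upwards [heq] with x hx
    rw [← hx]
    revert i
    simp only [Pi.sub_apply, Pi.smul_apply, Matrix.mulVec, dotProduct, smul_eq_mul,
      Fin.sum_univ_two, Matrix.sub_apply, Matrix.smul_apply]
    refine Fin.forall_fin_two.2 ⟨?_, ?_⟩
    · rw [Matrix.one_apply_eq, Matrix.one_apply_ne (by decide)]
      ring
    · rw [Matrix.one_apply_eq, Matrix.one_apply_ne (by decide)]
      ring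
  funext i
  rw [hae, intervalIntegral.integral_sub, intervalIntegral.integral_finsetSum,
    intervalIntegral.integral_finsetSum]
  · simp only [intervalIntegral.integral_const_mul]
    change _ = ∑ j, _ * cosCoeff S.l n (fun x => y x j) - ∑ j, _ * cosCoeff S.l n (fun x => y₂ x j)
    simp only [h2]
    rw [← Finset.sum_sub_distrib, Matrix.mulVec, dotProduct]
    refine Finset.sum_congr rfl fun j _ => ?_
    simp only [charMatrix, Matrix.sub_apply, Matrix.add_apply, Matrix.smul_apply, smul_eq_mul]
    rw [div_pow]
    ring
  · exact fun j _ => (hy2i j).const_mul _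
  · exact fun j _ => (hyi j).const_mul _
  · simp only [Fin.sum_univ_two]
    exact ((hyi 0).const_mul _).add ((hyi 1).const_mul _)
  · simp only [Fin.sum_univ_two]
    exact ((hy2i 0).const_mul _).add ((hy2i 1).const_mul _)

/-- The characteristic operator maps `cos (n x / l) • v` to `cos (n x / l) • M v`, where `M` is the
characteristic matrix of mode `n`. -/
lemma charEq_neumannMode_smul (hl : 0 < S.l) (n : ℕ) (v : Fin 2 → ℂ) :
    S.CharEq E z (fun x => (neumannMode S.l n x : ℂ) • v)
      (fun x => (neumannMode S.l n x : ℂ) • (S.charMatrix E n z).mulVec v) := by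
  have hd1 : ∀ x, HasDerivAt (fun x => (neumannMode S.l n x : ℂ) • v)
      (((-(n / S.l) * Real.sin (n / S.l * x) : ℝ) : ℂ) • v) x := fun x =>
    (hasDerivAt_neumannMode S.l n x).ofReal_comp.smul_const v
  have hd2 : ∀ x, HasDerivAt (fun x => ((-(n / S.l) * Real.sin (n / S.l * x) : ℝ) : ℂ) • v)
      (((-(n / S.l) ^ 2 * neumannMode S.l n x : ℝ) : ℂ) • v) x := fun x => by
    have := ((((hasDerivAt_id x).const_mul ((n : ℝ) / S.l)).sin).const_mul
      (-((n : ℝ) / S.l))).ofReal_comp.smul_const v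
    refine this.congr_deriv ?_
    congr 2
    simp only [neumannMode, id]
    ring
  have hc2 : Continuous fun x => ((-(n / S.l) ^ 2 * neumannMode S.l n x : ℝ) : ℂ) • v := by
    fun_prop
  refine ⟨_, fun x => ((-(n / S.l) ^ 2 * neumannMode S.l n x : ℝ) : ℂ) • v,
    ⟨fun x _ => (hd1 x).hasDerivWithinAt, ?_, fun x _ => ?_, by simp, ?_⟩, ?_⟩
  · obtain ⟨C, hC⟩ := (isCompact_Icc (a := 0) (b := S.l * Real.pi)).exists_bound_of_continuousOn
      hc2.continuousOn
    refine MemLp.of_bound hc2.aestronglyMeasurable C ?_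
    exact (ae_restrict_iff' measurableSet_Ioo).2
      (Filter.Eventually.of_forall fun x hx => hC x (Ioo_subset_Icc_self hx))
  · rw [intervalIntegral.integral_eq_sub_of_hasDerivAt (fun t _ => hd2 t)
      (hc2.intervalIntegrable _ _)]
    simp
  · have : Real.sin (n / S.l * (S.l * Real.pi)) = 0 := by
      rw [← mul_assoc, div_mul_cancel₀ _ hl.ne', Real.sin_nat_mul_pi]
    simp only [this, mul_zero, Complex.ofReal_zero, zero_smul]
  · refine Filter.Eventually.of_forall fun x => ?_
    simp only [charMatrix, Matrix.sub_mulVec, Matrix.add_mulVec, Matrix.smul_mulVec,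
      Matrix.mulVec_smul, Matrix.one_mulVec]
    funext i
    simp only [Pi.sub_apply, Pi.add_apply, Pi.smul_apply, smul_eq_mul]
    push_cast
    rw [div_pow]
    ring

lemma exists_cosCoeff_ne_zero (hl : 0 < S.l) {y : ℝ → Fin 2 → ℂ}
    (hy : ContinuousOn y (Icc 0 (S.l * Real.pi))) {x : ℝ} (hx : x ∈ Icc 0 (S.l * Real.pi))
    (hyx : y x ≠ 0) : ∃ n, (fun i => cosCoeff S.l n (fun x => y x i)) ≠ 0 := by
  by_contra! hall
  refine hyx (funext fun i => ?_)
  exact eq_zero_of_cosCoeff_eq_zero hl (continuousOn_pi.1 hy i)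
    (fun n => congrFun (hall n) i) x hx

/-- The eigenvalues of the linearization are exactly the eigenvalues of the modes. -/
lemma isCharValue_iff_exists_mode (hl : 0 < S.l) :
    S.IsCharValue E z ↔ ∃ n, S.IsCharValueOfMode E n z := by
  constructor
  · rintro ⟨y, ⟨x, hx, hyx⟩, hy⟩
    obtain ⟨n, hn⟩ := exists_cosCoeff_ne_zero hl hy.continuousOn hx hyx
    refine ⟨n, Matrix.exists_mulVec_eq_zero_iff.1 ⟨_, hn, ?_⟩⟩
    have := hy.charMatrix_mulVec_cosCoeff hl n
    rw [charMatrix] at this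
    rw [this]
    funext i
    simp [cosCoeff]
  · rintro ⟨n, hn⟩
    obtain ⟨v, hv, hnv⟩ := Matrix.exists_mulVec_eq_zero_iff.2 hn
    refine ⟨fun x => (neumannMode S.l n x : ℂ) • v, ⟨0, ⟨le_rfl, by positivity⟩, ?_⟩, ?_⟩
    · simpa [neumannMode] using hv
    · have := charEq_neumannMode_smul (S := S) (E := E) (z := z) hl n v
      rw [charMatrix, hnv] at this
      convert this using 1
      funext x
      simp

/-- Simplicity can be tested on the mode alone: `z` is simple as soon as it is an eigenvalue of
mode `n` only, the kernel of the characteristic matrix `M` of mode `n` is spanned by one vector `v`,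
and `M'(z) v` is not in the range of `M`. -/
lemma isSimpleCharValue_of_mode (hl : 0 < S.l) {n : ℕ} {v : Fin 2 → ℂ} (hv : v ≠ 0)
    (hker : (S.charMatrix E n z).mulVec v = 0)
    (hspan : ∀ w, (S.charMatrix E n z).mulVec w = 0 → ∃ c : ℂ, w = c • v)
    (hother : ∀ m, m ≠ n → ¬ S.IsCharValueOfMode E m z)
    (hjordan : ∀ w, (S.charMatrix E n z).mulVec w
      ≠ -(v + ((S.τ : ℂ) * Complex.exp (-z * S.τ)) • (S.B E).mulVec v)) :
    S.IsSimpleCharValue E z := by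
  have hκ := cosCoeff_neumannMode_ne_zero hl n
  set κ := cosCoeff S.l n (fun x => (neumannMode S.l n x : ℂ)) with hκdef
  have hcoeff : ∀ a : ℂ, cosCoeff S.l n (fun x => (neumannMode S.l n x : ℂ) * a) = κ * a := by
    intro a
    rw [hκdef, cosCoeff, cosCoeff, ← intervalIntegral.integral_mul_const]
    simp only [mul_assoc]
  have hCE : S.CharEq E z (fun x => (neumannMode S.l n x : ℂ) • v) 0 := by
    have := charEq_neumannMode_smul (S := S) (E := E) (z := z) hl n v
    rw [hker] at this
    convert this using 1
    funext x
    simp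
  refine ⟨fun x => (neumannMode S.l n x : ℂ) • v,
    ⟨⟨0, ⟨le_rfl, by positivity⟩, by simpa [neumannMode] using hv⟩, hCE⟩, ?_, ?_⟩
  · intro y' hy'
    have hy0 : ∀ m,
        (S.charMatrix E m z).mulVec (fun i => cosCoeff S.l m (fun x => y' x i)) = 0 := by
      intro m
      rw [hy'.charMatrix_mulVec_cosCoeff hl m]
      funext i
      simp [cosCoeff]
    obtain ⟨c, hc⟩ := hspan _ (hy0 n)
    refine ⟨κ⁻¹ * c, fun x hx => ?_⟩
    funext i
    have hcont : ContinuousOn (fun x => y' x i) (Icc 0 (S.l * Real.pi)) :=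
      continuousOn_pi.1 hy'.continuousOn i
    have hL : 0 ≤ S.l * Real.pi := by positivity
    have hsub := eq_zero_of_cosCoeff_eq_zero hl
      (f := fun x => y' x i - (neumannMode S.l n x : ℂ) * (κ⁻¹ * c * v i))
      (hcont.sub (by fun_prop)) (fun m => ?_) x hx
    · rw [sub_eq_zero] at hsub
      rw [hsub]
      simp only [Pi.smul_apply, smul_eq_mul]
      ring
    · have e1 : cosCoeff S.l m (fun x => y' x i - (neumannMode S.l n x : ℂ) * (κ⁻¹ * c * v i))
          = cosCoeff S.l m (fun x => y' x i)
            - cosCoeff S.l m (fun x => (neumannMode S.l n x : ℂ) * (κ⁻¹ * c * v i)) := by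
        unfold cosCoeff
        rw [← intervalIntegral.integral_sub]
        · simp only [mul_sub]
        · refine (ContinuousOn.mul (by fun_prop) ?_).intervalIntegrable
          rwa [uIcc_of_le hL]
        · exact (ContinuousOn.mul (by fun_prop) (by fun_prop)).intervalIntegrable
      rw [e1]
      by_cases hm : m = n
      · subst hm
        rw [hcoeff, show cosCoeff S.l m (fun x => y' x i) = c * v i from congrFun hc i]
        field_simp
        simp
      · have hz1 : ∀ w, (S.charMatrix E m z).mulVec w = 0 → w = 0 := fun w hw => by
          by_contra hw0
          exact hother m hm (Matrix.exists_mulVec_eq_zero_iff.1 ⟨w, hw0, hw⟩)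
        have h1 := congrFun (hz1 _ (hy0 m)) i
        have h2 : (fun i => cosCoeff S.l m (fun x => ((neumannMode S.l n x : ℂ) • v) i)) = 0 := by
          apply hz1
          rw [hCE.charMatrix_mulVec_cosCoeff hl m]
          funext i
          simp [cosCoeff]
        have h3 : cosCoeff S.l m (fun x => (neumannMode S.l n x : ℂ) * (κ⁻¹ * c * v i))
            = κ⁻¹ * c * cosCoeff S.l m (fun x => ((neumannMode S.l n x : ℂ) • v) i) := by
          unfold cosCoeff
          rw [← intervalIntegral.integral_const_mul]
          congr 1
          funext x
          simp only [Pi.smul_apply, smul_eq_mul]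
          ring
        have h1' : cosCoeff S.l m (fun x => y' x i) = 0 := h1
        have h2' : cosCoeff S.l m (fun x => ((neumannMode S.l n x : ℂ) • v) i) = 0 := congrFun h2 i
        rw [h3, h1', h2', mul_zero, sub_zero]
  · rintro ⟨w, hw⟩
    have h1 := hw.charMatrix_mulVec_cosCoeff hl n
    set W : Fin 2 → ℂ := fun i => cosCoeff S.l n (fun x => w x i)
    refine hjordan (κ⁻¹ • W) ?_
    rw [Matrix.mulVec_smul, h1]
    funext i
    have h2 : (fun x : ℝ => (-((neumannMode S.l n x : ℂ) • v
        + ((S.τ : ℂ) * Complex.exp (-z * S.τ)) •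
          (S.B E).mulVec ((neumannMode S.l n x : ℂ) • v))) i)
        = fun x => (neumannMode S.l n x : ℂ) *
          (-(v + ((S.τ : ℂ) * Complex.exp (-z * S.τ)) • (S.B E).mulVec v)) i := by
      funext x
      rw [Matrix.mulVec_smul]
      simp only [Pi.neg_apply, Pi.add_apply, Pi.smul_apply, smul_eq_mul]
      ring
    simp only [Pi.smul_apply, smul_eq_mul]
    rw [h2, hcoeff, inv_mul_cancel_left₀ hκ]

end DelayedRDSystem

/-! ### Roots of the characteristic functions -/

/-- The characteristic function `(z + c) (z + d) + r e^{-zτ} (z + c + β)` of a single mode of the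
delayed Holling-Tanner linearization. -/
noncomputable def charFn (c d β τ r : ℝ) (z : ℂ) : ℂ :=
  (z + c) * (z + d) + r * Complex.exp (-z * τ) * (z + c + β)

/-- The derivative of `charFn` in `z`. -/
noncomputable def charFnDeriv (c d β τ r : ℝ) (z : ℂ) : ℂ :=
  2 * z + c + d + r * Complex.exp (-z * τ) * (1 - τ * (z + c + β))

/-- The logarithmic form `τ z + log (z + c) + log (z + d) - log (z + c + β)` of the characteristic
equation: in the upper half-plane `charFn c d β τ r z = 0` says that its exponential is `-r`. -/
noncomputable def charLog (c d β τ : ℝ) (z : ℂ) : ℂ :=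
  τ * z + Complex.log (z + c) + Complex.log (z + d) - Complex.log (z + c + β)

/-- The derivative of `charLog` in `z`. -/
noncomputable def charLogDeriv (c d β τ : ℝ) (z : ℂ) : ℂ :=
  τ + (z + c)⁻¹ + (z + d)⁻¹ - (z + c + β)⁻¹

section CharFn

variable {c d β τ r : ℝ} {z : ℂ}

open ComplexConjugate in
lemma charFn_conj (c d β τ r : ℝ) (z : ℂ) :
    charFn c d β τ r (conj z) = conj (charFn c d β τ r z) := by
  simp [charFn, ← Complex.exp_conj]

open ComplexConjugate in
lemma charFnDeriv_conj (c d β τ r : ℝ) (z : ℂ) :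
    charFnDeriv c d β τ r (conj z) = conj (charFnDeriv c d β τ r z) := by
  simp only [charFnDeriv, map_add, map_mul, map_sub, map_one, map_ofNat, Complex.conj_ofReal,
    ← Complex.exp_conj, map_neg]

lemma hasDerivAt_charFn (c d β τ r : ℝ) (z : ℂ) :
    HasDerivAt (charFn c d β τ r) (charFnDeriv c d β τ r z) z := by
  have h1 : HasDerivAt (fun z : ℂ => z) 1 z := hasDerivAt_id z
  have h := ((h1.add_const (c : ℂ)).mul (h1.add_const (d : ℂ))).add
    (((h1.neg.mul_const (τ : ℂ)).cexp.const_mul (r : ℂ)).mul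
      ((h1.add_const (c : ℂ)).add_const (β : ℂ)))
  refine h.congr_deriv ?_
  simp only [charFnDeriv, Pi.neg_apply]
  ring

lemma add_ofReal_ne_zero_of_im_pos (hz : 0 < z.im) (a : ℝ) : z + a ≠ 0 := fun h => by
  have := congrArg Complex.im h
  simp at this
  exact hz.ne' this

lemma add_add_ofReal_ne_zero_of_im_pos (hz : 0 < z.im) (a b : ℝ) : z + a + b ≠ 0 := by
  have := add_ofReal_ne_zero_of_im_pos hz (a + b)
  rwa [Complex.ofReal_add, ← add_assoc] at this

lemma add_ofReal_mem_slitPlane (hz : 0 < z.im) (a : ℝ) : z + a ∈ Complex.slitPlane := by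
  right
  simpa using hz.ne'

lemma hasDerivAt_charLog (c d β τ : ℝ) (hz : 0 < z.im) :
    HasDerivAt (charLog c d β τ) (charLogDeriv c d β τ z) z := by
  have h1 : HasDerivAt (fun z : ℂ => z) 1 z := hasDerivAt_id z
  have hcb : z + c + β ∈ Complex.slitPlane := by
    have := add_ofReal_mem_slitPlane hz (c + β)
    push_cast at this
    rwa [← add_assoc] at this
  have h := (((h1.const_mul (τ : ℂ)).add
    ((h1.add_const (c : ℂ)).clog (add_ofReal_mem_slitPlane hz c))).add
    ((h1.add_const (d : ℂ)).clog (add_ofReal_mem_slitPlane hz d))).sub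
      (((h1.add_const (c : ℂ)).add_const (β : ℂ)).clog hcb)
  refine h.congr_deriv ?_
  simp only [charLogDeriv, mul_one, one_div]

/-- The derivative of `charLog` maps the closed right part of the upper half-plane into the lower
half-plane, since there `z + c` is closer to `0` than `z + c + β`. -/
lemma charLogDeriv_im_neg (hβ : 0 < β) (hc : 0 < 2 * c + β) (hre : 0 ≤ z.re) (him : 0 < z.im) :
    (charLogDeriv c d β τ z).im < 0 := by
  have e : (charLogDeriv c d β τ z).im = -z.im / ((z.re + c) * (z.re + c) + z.im * z.im)
      + -z.im / ((z.re + d) * (z.re + d) + z.im * z.im)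
      - -z.im / ((z.re + c + β) * (z.re + c + β) + z.im * z.im) := by
    simp [charLogDeriv, Complex.inv_im, Complex.normSq_apply]
  rw [e]
  have h1 : 0 < (z.re + c) * (z.re + c) + z.im * z.im :=
    add_pos_of_nonneg_of_pos (mul_self_nonneg _) (mul_pos him him)
  have h2 : 0 ≤ z.im / ((z.re + d) * (z.re + d) + z.im * z.im) :=
    div_nonneg him.le (add_nonneg (mul_self_nonneg _) (mul_self_nonneg _))
  have h3 : z.im / ((z.re + c + β) * (z.re + c + β) + z.im * z.im)
      < z.im / ((z.re + c) * (z.re + c) + z.im * z.im) := by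
    apply div_lt_div_of_pos_left him h1
    nlinarith
  simp only [neg_div]
  linarith

/-- The Noshiro-Warschawski argument: on a convex region where the derivative lies in the lower
half-plane, so do the difference quotients. -/
lemma charLog_slope_im_neg (hβ : 0 < β) (hc : 0 < 2 * c + β) {p q : ℂ} (hp : 0 ≤ p.re)
    (hp' : 0 < p.im) (hq : 0 ≤ q.re) (hq' : 0 < q.im) (hne : p ≠ q) :
    ((charLog c d β τ p - charLog c d β τ q) / (p - q)).im < 0 := by
  have hne' : p - q ≠ 0 := sub_ne_zero.2 hne
  set γ : ℝ → ℂ := fun t => q + t * (p - q) with hγ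
  have hγre : ∀ t ∈ Icc (0 : ℝ) 1, 0 ≤ (γ t).re := fun t ht => by
    have : (γ t).re = (1 - t) * q.re + t * p.re := by simp [hγ]; ring
    rw [this]
    have := ht.1
    have := sub_nonneg.2 ht.2
    positivity
  have hγim : ∀ t ∈ Icc (0 : ℝ) 1, 0 < (γ t).im := fun t ht => by
    have e : (γ t).im = (1 - t) * q.im + t * p.im := by simp [hγ]; ring
    rw [e]
    rcases eq_or_lt_of_le ht.1 with h0 | h0
    · rw [← h0]; simpa using hq'
    · have := mul_pos h0 hp'
      have := mul_nonneg (sub_nonneg.2 ht.2) hq'.le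
      linarith
  have hderiv : ∀ t ∈ Icc (0 : ℝ) 1, HasDerivAt (fun t : ℝ => (charLog c d β τ (γ t) / (p - q)).im)
      (charLogDeriv c d β τ (γ t)).im t := by
    intro t ht
    have h1 : HasDerivAt γ (p - q) t := by
      have := ((hasDerivAt_id t).ofReal_comp.mul_const (p - q)).const_add q
      simpa [hγ] using this
    have h2 := ((hasDerivAt_charLog c d β τ (hγim t ht)).scomp_of_eq t h1 rfl).div_const (p - q)
    have h3 := Complex.imCLM.hasFDerivAt.comp_hasDerivAt t h2
    refine h3.congr_deriv ?_
    simp [mul_div_cancel_left₀ _ hne']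
  have hanti := strictAntiOn_of_deriv_neg (convex_Icc (0 : ℝ) 1)
    (f := fun t : ℝ => (charLog c d β τ (γ t) / (p - q)).im)
    (fun t ht => (hderiv t ht).continuousAt.continuousWithinAt) (fun t ht => by
      have ht' := interior_subset ht
      rw [(hderiv t ht').deriv]
      exact charLogDeriv_im_neg hβ hc (hγre t ht') (hγim t ht'))
  have := hanti (left_mem_Icc.2 zero_le_one) (right_mem_Icc.2 zero_le_one) zero_lt_one
  simp only [hγ, Complex.ofReal_one, one_mul, Complex.ofReal_zero, zero_mul, add_zero,
    add_sub_cancel] at this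
  rw [sub_div, Complex.sub_im]
  linarith

lemma exp_charLog (c d β τ : ℝ) (hz : 0 < z.im) :
    Complex.exp (charLog c d β τ z)
      = Complex.exp (τ * z) * (z + c) * (z + d) / (z + c + β) := by
  have hcb := add_add_ofReal_ne_zero_of_im_pos hz c β
  rw [charLog, Complex.exp_sub, Complex.exp_add, Complex.exp_add,
    Complex.exp_log (add_ofReal_ne_zero_of_im_pos hz c),
    Complex.exp_log (add_ofReal_ne_zero_of_im_pos hz d), Complex.exp_log hcb]

lemma exp_charLog_of_charFn_eq_zero (hz : 0 < z.im) (h : charFn c d β τ r z = 0) :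
    Complex.exp (charLog c d β τ z) = -r := by
  have hcb := add_add_ofReal_ne_zero_of_im_pos hz c β
  rw [exp_charLog c d β τ hz, div_eq_iff hcb]
  have h1 : Complex.exp (τ * z) * Complex.exp (-z * τ) = 1 := by
    rw [← Complex.exp_add, neg_mul, mul_comm, add_neg_cancel, Complex.exp_zero]
  unfold charFn at h
  linear_combination Complex.exp (τ * z) * h - r * (z + c + β) * h1

lemma charFn_eq_zero_of_exp_charLog (hz : 0 < z.im)
    (h : Complex.exp (charLog c d β τ z) = -r) : charFn c d β τ r z = 0 := by
  have hcb := add_add_ofReal_ne_zero_of_im_pos hz c β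
  rw [exp_charLog c d β τ hz, div_eq_iff hcb] at h
  have h1 : Complex.exp (τ * z) * Complex.exp (-z * τ) = 1 := by
    rw [← Complex.exp_add, neg_mul, mul_comm, add_neg_cancel, Complex.exp_zero]
  unfold charFn
  linear_combination Complex.exp (-z * τ) * h - (z + c) * (z + d) * h1

/-- In a root, the branch of the logarithm is the principal one. -/
lemma charLog_eq_of_charFn_eq_zero (hr : 0 < r) (hcβ : 0 < c + β) (hτ : 0 ≤ τ) (hre : 0 ≤ z.re)
    (him : 0 < z.im) (hbd : τ * z.im < Real.pi) (h : charFn c d β τ r z = 0) :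
    charLog c d β τ z = Real.log r + Real.pi * Complex.I := by
  have h1 := exp_charLog_of_charFn_eq_zero him h
  have h2 : Complex.exp (Real.log r + Real.pi * Complex.I) = -r := by
    rw [Complex.exp_add, Complex.exp_pi_mul_I, ← Complex.ofReal_exp, Real.exp_log hr]
    ring
  obtain ⟨n, hn⟩ := Complex.exp_eq_exp_iff_exists_int.1 (h1.trans h2.symm)
  have himF : (charLog c d β τ z).im
      = τ * z.im + (z + c).arg + (z + d).arg - (z + c + β).arg := by
    simp [charLog, Complex.log_im]
  have hpos : ∀ w : ℂ, 0 < w.im → 0 < w.arg ∧ w.arg ≤ Real.pi := fun w hw => by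
    refine ⟨?_, Complex.arg_le_pi w⟩
    refine lt_of_le_of_ne (Complex.arg_nonneg_iff.2 hw.le) fun h0 => hw.ne' ?_
    exact (Complex.arg_eq_zero_iff.1 h0.symm).2
  have hc := hpos (z + c) (by simpa using him)
  have hd := hpos (z + d) (by simpa using him)
  have hcb := hpos (z + c + β) (by simpa using him)
  have hcb2 : (z + c + β).arg < Real.pi / 2 := by
    refine (abs_lt.1 (Complex.abs_arg_lt_pi_div_two_iff.2 (Or.inl ?_))).2
    simp
    linarith
  have hnim : (charLog c d β τ z).im = Real.pi + n * (2 * Real.pi) := by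
    rw [hn]; simp
  have hpi := Real.pi_pos
  have hτy : 0 ≤ τ * z.im := by positivity
  have hn1 : (n : ℝ) < 1 :=
    lt_of_mul_lt_mul_right (by linarith : (n : ℝ) * (2 * Real.pi) < 1 * (2 * Real.pi))
      (by positivity)
  have hn2 : (-1 : ℝ) < n :=
    lt_of_mul_lt_mul_right (by linarith : -1 * (2 * Real.pi) < (n : ℝ) * (2 * Real.pi))
      (by positivity)
  have hn0 : n = 0 := by
    have a1 : n < 1 := by exact_mod_cast hn1
    have a2 : -1 < n := by exact_mod_cast hn2
    omega
  rw [hn, hn0]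
  simp

lemma charLog_re_of_modulus (hr : 0 < r) {ω : ℝ} (hω : 0 < ω)
    (hmod : (ω ^ 2 + c ^ 2) * (ω ^ 2 + d ^ 2) = r ^ 2 * (ω ^ 2 + (c + β) ^ 2)) :
    (charLog c d β τ (ω * Complex.I)).re = Real.log r := by
  have him : 0 < ((ω : ℂ) * Complex.I).im := by simpa using hω
  have h1 := congrArg norm (exp_charLog c d β τ him)
  rw [Complex.norm_exp] at h1
  have hn : ∀ a : ℝ, ‖(ω : ℂ) * Complex.I + a‖ ^ 2 = ω ^ 2 + a ^ 2 := fun a => by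
    rw [Complex.sq_norm, Complex.normSq_apply]; simp; ring
  have hcb : ‖(ω : ℂ) * Complex.I + c + β‖ ^ 2 = ω ^ 2 + (c + β) ^ 2 := by
    rw [← hn]; push_cast; rw [add_assoc]
  have h2 : Real.exp (charLog c d β τ (ω * Complex.I)).re ^ 2 = r ^ 2 := by
    rw [h1, norm_div, norm_mul, norm_mul, Complex.norm_exp]
    have : ((τ : ℂ) * (ω * Complex.I)).re = 0 := by simp
    rw [this, Real.exp_zero, one_mul, div_pow, mul_pow, hn, hn, hcb, hmod]
    have : 0 < ω ^ 2 + (c + β) ^ 2 := by positivity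
    field_simp
  have h3 : Real.exp (charLog c d β τ (ω * Complex.I)).re = r :=
    (pow_left_inj₀ (Real.exp_pos _).le hr.le two_ne_zero).1 h2
  rw [← h3, Real.log_exp]

/-- Location of the roots in the first quadrant. Let `ω > 0` satisfy the modulus condition of the
characteristic equation. If the phase of `charLog` at `iω` is below `π`, there are no roots, and if
it equals `π`, the only root is `iω`: for a root `z ≠ iω` the number
`charLog z - charLog (iω) = i (π - phase)` has a quotient by `z - iω` in the lower half-plane, which
makes the real part of `z - iω` negative. -/
theorem eq_of_charFn_eq_zero (hβ : 0 < β) (hc : 0 < 2 * c + β) (hcβ : 0 < c + β) (hr : 0 < r)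
    (hτ : 0 ≤ τ) {ω : ℝ} (hω : 0 < ω)
    (hmod : (ω ^ 2 + c ^ 2) * (ω ^ 2 + d ^ 2) = r ^ 2 * (ω ^ 2 + (c + β) ^ 2))
    (harg : (charLog c d β τ (ω * Complex.I)).im ≤ Real.pi)
    (hre : 0 ≤ z.re) (him : 0 < z.im) (hbd : τ * z.im < Real.pi) (h : charFn c d β τ r z = 0) :
    z = ω * Complex.I ∧ (charLog c d β τ (ω * Complex.I)).im = Real.pi := by
  have h1 := charLog_eq_of_charFn_eq_zero hr hcβ hτ hre him hbd h
  have h2 := charLog_re_of_modulus (τ := τ) hr hω hmod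
  set q : ℂ := ω * Complex.I with hq
  have hqim : 0 < q.im := by simpa [hq] using hω
  have hqre : q.re = 0 := by simp [hq]
  by_cases hne : z = q
  · refine ⟨hne, ?_⟩
    rw [← hne, h1]; simp
  exfalso
  have h3 := charLog_slope_im_neg (d := d) (τ := τ) hβ hc hre him hqre.ge hqim hne
  have hne' : z - q ≠ 0 := sub_ne_zero.2 hne
  set M := (charLog c d β τ z - charLog c d β τ q) / (z - q) with hM
  have h4 : M * (z - q) = charLog c d β τ z - charLog c d β τ q := div_mul_cancel₀ _ hne'
  rw [h1] at h4
  have hR := congrArg Complex.re h4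
  have hI := congrArg Complex.im h4
  simp [h2, hqre] at hR hI
  -- with `z - q = x + i y`, the equations `M.re * x = M.im * y` and
  -- `M.re * y + M.im * x = π - phase` combine to `M.im * (x ^ 2 + y ^ 2) = (π - phase) * x`
  have h5 : M.im * (z.re ^ 2 + (z.im - q.im) ^ 2) = (Real.pi - (charLog c d β τ q).im) * z.re := by
    linear_combination z.re * hI - (z.im - q.im) * hR
  have h6 : 0 ≤ M.im * (z.re ^ 2 + (z.im - q.im) ^ 2) := by
    rw [h5]; exact mul_nonneg (by linarith) hre
  have h7 : z.re ^ 2 + (z.im - q.im) ^ 2 = 0 := by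
    by_contra h0
    have : 0 < z.re ^ 2 + (z.im - q.im) ^ 2 := lt_of_le_of_ne (by positivity) (Ne.symm h0)
    linarith [mul_neg_of_neg_of_pos h3 this]
  obtain ⟨h8, h9⟩ := (add_eq_zero_iff_of_nonneg (sq_nonneg _) (sq_nonneg _)).1 h7
  apply hne
  apply Complex.ext
  · rw [hqre]; exact pow_eq_zero_iff two_ne_zero |>.1 h8
  · exact sub_eq_zero.1 (pow_eq_zero_iff two_ne_zero |>.1 h9)

lemma arg_add_mul_I {ω : ℝ} (hω : 0 < ω) (a : ℝ) :
    ((ω : ℂ) * Complex.I + a).arg = Real.pi / 2 - Real.arctan (a / ω) := by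
  have hs : 0 < √(1 + (a / ω) ^ 2) := by positivity
  have h := Complex.arg_mul_cos_add_sin_mul_I (r := ω * √(1 + (a / ω) ^ 2))
    (θ := Real.pi / 2 - Real.arctan (a / ω)) (by positivity)
    ⟨by linarith [Real.arctan_lt_pi_div_two (a / ω), Real.pi_pos],
      by linarith [Real.neg_pi_div_two_lt_arctan (a / ω), Real.pi_pos]⟩
  rw [← h]
  congr 1
  rw [← Complex.ofReal_cos, ← Complex.ofReal_sin, Real.cos_pi_div_two_sub, Real.sin_pi_div_two_sub,
    Real.sin_arctan, Real.cos_arctan]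
  apply Complex.ext
  · simp
    field_simp
  · simp
    field_simp

lemma charLog_im_mul_I {ω : ℝ} (hω : 0 < ω) :
    (charLog c d β τ (ω * Complex.I)).im = τ * ω + Real.pi / 2 - Real.arctan (c / ω)
      - Real.arctan (d / ω) + Real.arctan ((c + β) / ω) := by
  have h : ((ω : ℂ) * Complex.I + c + β) = (ω : ℂ) * Complex.I + ((c + β : ℝ) : ℂ) := by
    push_cast; ring
  rw [charLog]
  simp only [Complex.sub_im, Complex.add_im, Complex.log_im]
  rw [h, arg_add_mul_I hω, arg_add_mul_I hω, arg_add_mul_I hω]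
  simp
  ring

/-- Beyond `r + β` the quadratic term dominates the delayed one, which bounds the imaginary parts of
roots in the first quadrant. -/
lemma im_le_of_charFn_eq_zero (hβ : 0 ≤ β) (hr : 0 ≤ r) (hτ : 0 ≤ τ) (hre : 0 ≤ z.re)
    (him : 0 < z.im) (h : charFn c d β τ r z = 0) : z.im ≤ r + β := by
  by_contra! hlt
  have h1 : z.im ≤ ‖z + c‖ := by
    simpa using (le_abs_self _).trans (Complex.abs_im_le_norm (z + c))
  have h2 : z.im ≤ ‖z + d‖ := by
    simpa using (le_abs_self _).trans (Complex.abs_im_le_norm (z + d))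
  have h3 : ‖Complex.exp (-z * τ)‖ ≤ 1 := by
    rw [Complex.norm_exp, Real.exp_le_one_iff]
    simp
    positivity
  have h4 : ‖z + c + β‖ ≤ ‖z + c‖ + β := by
    refine (norm_add_le _ _).trans ?_
    rw [Complex.norm_real, Real.norm_of_nonneg hβ]
  have h5 : ‖z + c‖ * ‖z + d‖ ≤ r * (‖z + c‖ + β) := by
    have : (z + c) * (z + d) = -(r * Complex.exp (-z * τ) * (z + c + β)) :=
      eq_neg_of_add_eq_zero_left h
    rw [← norm_mul, this, norm_neg, norm_mul, norm_mul, Complex.norm_real, Real.norm_of_nonneg hr]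
    calc r * ‖Complex.exp (-z * τ)‖ * ‖z + c + β‖ ≤ r * 1 * (‖z + c‖ + β) := by gcongr
      _ = _ := by ring
  nlinarith [mul_nonneg hr hβ]

/-- For strongly damped modes (`d` large) all roots in the closed right half-plane are real. -/
lemma im_eq_zero_of_charFn_eq_zero (hβ : 0 ≤ β) (hr : 0 ≤ r) (hτ : 0 ≤ τ) (hd : r < d)
    (hd1 : r * β * (1 + d * τ) < (d - r) ^ 2) (hd2 : r * β * τ ≤ 2 * (d - r))
    (hre : 0 ≤ z.re) (h : charFn c d β τ r z = 0) : z.im = 0 := by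
  by_contra hne
  set e := Complex.exp (-z * τ) with he
  have hexp : Real.exp (-(z.re * τ)) ≤ 1 := by
    rw [Real.exp_le_one_iff]; have := mul_nonneg hre hτ; linarith
  have hexp0 := (Real.exp_pos (-(z.re * τ))).le
  have he1 : e.re = Real.exp (-(z.re * τ)) * Real.cos (z.im * τ) := by
    simp [he, Complex.exp_re]
  have he2 : e.im = -(Real.exp (-(z.re * τ)) * Real.sin (z.im * τ)) := by
    simp [he, Complex.exp_im]
  have he1' : |e.re| ≤ 1 := by
    rw [he1, abs_mul, abs_of_nonneg hexp0]
    exact mul_le_one₀ hexp (abs_nonneg _) (Real.abs_cos_le_one _)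
  have he2' : -(z.im * e.im) ≤ τ * z.im ^ 2 := by
    calc -(z.im * e.im) ≤ |z.im * e.im| := neg_le_abs _
      _ = |z.im| * (Real.exp (-(z.re * τ)) * |Real.sin (z.im * τ)|) := by
        rw [he2, abs_mul, abs_neg, abs_mul, abs_of_nonneg hexp0]
      _ ≤ |z.im| * (1 * |z.im * τ|) :=
        mul_le_mul_of_nonneg_left (mul_le_mul hexp Real.abs_sin_le_abs (abs_nonneg _) zero_le_one)
          (abs_nonneg _)
      _ = τ * z.im ^ 2 := by rw [abs_mul, abs_of_nonneg hτ, ← sq_abs z.im]; ring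
  have hR := congrArg Complex.re h
  have hI := congrArg Complex.im h
  simp only [charFn, ← he, Complex.add_re, Complex.mul_re, Complex.add_im, Complex.mul_im,
    Complex.ofReal_re, Complex.ofReal_im, Complex.zero_re, Complex.zero_im, add_zero, zero_mul,
    sub_zero] at hR hI
  have key : z.im * ((z.re + d + r * e.re) ^ 2 + (z.im + r * e.im) ^ 2)
      = r * β * (z.im * e.re - (z.re + d) * e.im) := by
    linear_combination (z.re + d + r * e.re) * hI - (z.im + r * e.im) * hR
  have hy : 0 < z.im ^ 2 := by positivity
  have hW : z.re + d - r ≤ z.re + d + r * e.re := by nlinarith [(abs_le.1 he1').1]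
  have hW2 : (z.re + d - r) ^ 2 ≤ (z.re + d + r * e.re) ^ 2 :=
    pow_le_pow_left₀ (by linarith) hW 2
  have h1 : z.im ^ 2 * (z.re + d - r) ^ 2 ≤ z.im ^ 2 * (r * β * (1 + (z.re + d) * τ)) := by
    calc z.im ^ 2 * (z.re + d - r) ^ 2
        ≤ z.im ^ 2 * ((z.re + d + r * e.re) ^ 2 + (z.im + r * e.im) ^ 2) :=
          mul_le_mul_of_nonneg_left (by nlinarith [sq_nonneg (z.im + r * e.im)]) hy.le
      _ = r * β * (z.im ^ 2 * e.re + (z.re + d) * -(z.im * e.im)) := by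
          linear_combination z.im * key
      _ ≤ r * β * (z.im ^ 2 * 1 + (z.re + d) * (τ * z.im ^ 2)) := by
          have := (abs_le.1 he1').2
          have : 0 ≤ z.re + d := by linarith
          gcongr
      _ = _ := by ring
  have h2 := le_of_mul_le_mul_left h1 hy
  have e1 : (z.re + d - r) ^ 2 = (d - r) ^ 2 + z.re * (2 * (d - r)) + z.re ^ 2 := by ring
  have e2 : r * β * (1 + (z.re + d) * τ) = r * β * (1 + d * τ) + z.re * (r * β * τ) := by ring
  linarith [mul_le_mul_of_nonneg_left hd2 hre, sq_nonneg z.re]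

lemma charFn_ofReal (c d β τ r x : ℝ) : charFn c d β τ r x
    = (((x + c) * (x + d) + r * Real.exp (-x * τ) * (x + c + β) : ℝ) : ℂ) := by
  simp [charFn]

lemma charFn_zero (c d β τ r : ℝ) : charFn c d β τ r 0 = ((c * d + r * (c + β) : ℝ) : ℂ) := by
  simp [charFn]

/-- No positive roots when the characteristic function is nonnegative at `0`. Where `x + c < 0`, the
value at `x` exceeds that at `0` because `e^{-xτ} ≥ 1 - xτ`; the numerical hypotheses make the
resulting slope positive. -/
lemma charFn_ofReal_ne_zero (hd : 0 ≤ d) (hβ : 0 < β) (hβ' : β ≤ 3 / 4) (hc : -(3 / 10) ≤ c)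
    (hcβ : 0 ≤ c + β)
    (hr : 14 / 5 ≤ r) (hrτ : r * τ ≤ 7 / 5) (h0 : 0 ≤ c * d + r * (c + β))
    {x : ℝ} (hx : 0 < x) : charFn c d β τ r x ≠ 0 := by
  rw [charFn_ofReal, Complex.ofReal_ne_zero]
  refine ne_of_gt ?_
  rcases le_or_gt (-c) x with h | h
  · have h1 : 0 ≤ (x + c) * (x + d) := mul_nonneg (by linarith) (by linarith)
    have h2 : 0 < r * Real.exp (-x * τ) * (x + c + β) :=
      mul_pos (mul_pos (by linarith) (Real.exp_pos _)) (by linarith)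
    linarith
  · have h1 : 1 - x * τ ≤ Real.exp (-x * τ) := by
      have := Real.add_one_le_exp (-x * τ); linarith
    have hcb : 0 ≤ x + c + β := by linarith
    have h2 : r * (1 - x * τ) * (x + c + β) ≤ r * Real.exp (-x * τ) * (x + c + β) := by gcongr
    have h3 : r * τ * (c + β) ≤ 7 / 5 * (3 / 4) :=
      mul_le_mul hrτ (by linarith) (by linarith) (by norm_num)
    have h4 : r * τ * x ≤ 7 / 5 * (3 / 10) :=
      mul_le_mul hrτ (by linarith) hx.le (by norm_num)
    have h5 : 0 < x * (c + d + r - r * τ * (c + β) + x - r * τ * x) :=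
      mul_pos hx (by linarith)
    have h6 : (x + c) * (x + d) + r * (1 - x * τ) * (x + c + β) = c * d + r * (c + β)
        + x * (c + d + r - r * τ * (c + β) + x - r * τ * x) := by ring
    linarith

end CharFn

/-! ### The coexistence state and its linearization -/

/-- The common value `(√41 - 1) / 20` of both components of the coexistence state. -/
noncomputable def coexU : ℝ := (√41 - 1) / 20

/-- The entry `∂f/∂u` of the Jacobian matrix at the coexistence state. -/
noncomputable def jacUU : ℝ := 11 / 10 - 31 / 10 * coexU

/-- Minus the entry `∂f/∂v` of the Jacobian matrix at the coexistence state. -/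
noncomputable def jacUV : ℝ := 1 - coexU

/-- The characteristic function of mode `n` at the coexistence state. -/
noncomputable def modeFn (n : ℕ) (τ r : ℝ) (z : ℂ) : ℂ :=
  charFn ((n : ℝ) ^ 2 / 250 - jacUU) (2 * (n : ℝ) ^ 2 / 5) jacUV τ r z

/-- The derivative of `modeFn` in `z`. -/
noncomputable def modeFnDeriv (n : ℕ) (τ r : ℝ) (z : ℂ) : ℂ :=
  charFnDeriv ((n : ℝ) ^ 2 / 250 - jacUU) (2 * (n : ℝ) ^ 2 / 5) jacUV τ r z

lemma coexU_bounds : 0.27015621 < coexU ∧ coexU < 0.270156215 := by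
  have h1 : (6.4031242 : ℝ) < √41 := Real.lt_sqrt_of_sq_lt (by norm_num)
  have h2 : √41 < (6.4031243 : ℝ) := (Real.sqrt_lt' (by norm_num)).2 (by norm_num)
  unfold coexU
  constructor <;> linarith

lemma coexU_sq : coexU ^ 2 = 1 / 10 - coexU / 10 := by
  have h : √41 ^ 2 = (41 : ℝ) := Real.sq_sqrt (by norm_num)
  unfold coexU
  linear_combination h / 400

lemma coexU_pos : 0 < coexU := by linarith [coexU_bounds.1]

lemma jacUU_bounds : 0.2625157 < jacUU ∧ jacUU < 0.2625158 := by
  obtain ⟨h1, h2⟩ := coexU_bounds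
  unfold jacUU
  constructor <;> linarith

lemma jacUV_bounds : 0.7298437 < jacUV ∧ jacUV < 0.7298438 := by
  obtain ⟨h1, h2⟩ := coexU_bounds
  unfold jacUV
  constructor <;> linarith

lemma jacUV_sub_jacUU_bounds : 0.467328 < jacUV - jacUU ∧ jacUV - jacUU < 0.4673281 := by
  obtain ⟨h1, h2⟩ := coexU_bounds
  unfold jacUV jacUU
  constructor <;> linarith

lemma hollingTannerFamily_isSteadyState (μ : ℝ × ℝ) :
    (hollingTannerFamily μ).IsSteadyState (coexU, coexU) := by
  have h := coexU_pos
  have h1 : coexU + 0.1 ≠ 0 := by positivity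
  constructor
  · simp only [hollingTannerFamily, hollingTanner]
    rw [sub_eq_zero, eq_div_iff h1]
    linear_combination (-coexU) * coexU_sq
  · simp only [hollingTannerFamily, hollingTanner]
    rw [div_self h.ne']
    ring

lemma hollingTannerFamily_isSteadyState_iff {τ r : ℝ} (hr : 0 < r) (E : ℝ × ℝ) :
    (0 < E.1 ∧ 0 < E.2 ∧ (hollingTannerFamily (τ, r)).IsSteadyState E) ↔ E = (coexU, coexU) := by
  constructor
  · rintro ⟨hu, hv, hf, hg⟩
    simp only [hollingTannerFamily, hollingTanner] at hf hg
    have h1 : E.2 = E.1 := by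
      have h2 : 1 - E.2 / E.1 = 0 := by
        rcases mul_eq_zero.1 hg with h | h
        · exact absurd h (by positivity)
        · exact h
      field_simp at h2
      linarith
    have h3 : E.1 + 0.1 ≠ 0 := by positivity
    rw [h1, sub_eq_zero, eq_div_iff h3] at hf
    have h4 : E.1 * ((E.1 - coexU) * (E.1 + coexU + 1 / 10)) = 0 := by
      linear_combination -hf - E.1 * coexU_sq
    have h5 : E.1 = coexU := by
      rcases mul_eq_zero.1 h4 with h | h
      · exact absurd h hu.ne'
      · rcases mul_eq_zero.1 h with h | h
        · linarith
        · linarith [coexU_pos]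
    exact Prod.ext h5 (h1.trans h5)
  · rintro rfl
    exact ⟨coexU_pos, coexU_pos, hollingTannerFamily_isSteadyState _⟩

lemma hollingTannerFamily_A (μ : ℝ × ℝ) :
    (hollingTannerFamily μ).A (coexU, coexU) = !![(jacUU : ℂ), -(jacUV : ℂ); 0, 0] := by
  have h := coexU_pos
  have h1 : coexU + 0.1 ≠ 0 := by positivity
  have e1 : deriv (fun s : ℝ => s * (1 - s) - 1 * s * coexU / (s + 0.1)) coexU = jacUU := by
    have hid := hasDerivAt_id coexU
    have := (hid.mul (hid.const_sub 1)).sub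
      (((hid.const_mul 1).mul_const coexU).div (hid.add_const 0.1) h1)
    refine HasDerivAt.deriv (this.congr_deriv ?_)
    have hq : (1 * 1 * coexU * (coexU + 0.1) - 1 * coexU * coexU * 1) / (coexU + 0.1) ^ 2
        = 11 / 10 * coexU - 1 / 10 := by
      rw [div_eq_iff (pow_ne_zero 2 h1)]
      linear_combination (-(11 / 10 * coexU + 1 / 100)) * coexU_sq
    simp only [id, jacUU, hq]
    ring
  have e2 : deriv (fun s : ℝ => coexU * (1 - coexU) - 1 * coexU * s / (coexU + 0.1)) coexU
      = -jacUV := by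
    have := (((hasDerivAt_id coexU).const_mul (1 * coexU)).div_const (coexU + 0.1)).const_sub
      (coexU * (1 - coexU))
    refine HasDerivAt.deriv (this.congr_deriv ?_)
    rw [jacUV, neg_inj, div_eq_iff h1]
    linear_combination coexU_sq
  have e3 : deriv (fun s : ℝ => μ.2 * s * (1 - coexU / coexU)) coexU = 0 := by
    simp [div_self h.ne']
  simp only [DelayedRDSystem.A, hollingTannerFamily, hollingTanner, e1, e2, e3, deriv_const]
  simp

lemma hollingTannerFamily_B (μ : ℝ × ℝ) :
    (hollingTannerFamily μ).B (coexU, coexU) = !![0, 0; (μ.2 : ℂ), -(μ.2 : ℂ)] := by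
  have h := coexU_pos
  have e1 : deriv (fun s : ℝ => μ.2 * coexU * (1 - coexU / s)) coexU = μ.2 := by
    have := (((hasDerivAt_inv h.ne').const_mul coexU).const_sub 1).const_mul (μ.2 * coexU)
    simp only [← div_eq_mul_inv] at this
    refine HasDerivAt.deriv (this.congr_deriv ?_)
    field_simp
  have e2 : deriv (fun s : ℝ => μ.2 * coexU * (1 - s / coexU)) coexU = -μ.2 := by
    have := (((hasDerivAt_id coexU).div_const coexU).const_sub 1).const_mul (μ.2 * coexU)
    refine HasDerivAt.deriv (this.congr_deriv ?_)
    field_simp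
  simp only [DelayedRDSystem.B, hollingTannerFamily, hollingTanner, e1, e2, deriv_const]
  simp

lemma hollingTannerFamily_l_pos (μ : ℝ × ℝ) : 0 < (hollingTannerFamily μ).l := by
  simp [hollingTannerFamily, hollingTanner]

lemma hollingTannerFamily_charMatrix (μ : ℝ × ℝ) (n : ℕ) (z : ℂ) :
    (hollingTannerFamily μ).charMatrix (coexU, coexU) n z =
      !![z + (((n : ℝ) ^ 2 / 250 - jacUU : ℝ) : ℂ), (jacUV : ℂ);
        -(μ.2 * Complex.exp (-z * μ.1)),
        z + ((2 * (n : ℝ) ^ 2 / 5 : ℝ) : ℂ) + μ.2 * Complex.exp (-z * μ.1)] := by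
  rw [DelayedRDSystem.charMatrix, hollingTannerFamily_A, hollingTannerFamily_B]
  ext i j
  fin_cases i <;> fin_cases j <;>
    simp [DelayedRDSystem.D, hollingTannerFamily, hollingTanner] <;> ring

lemma isCharValueOfMode_iff_modeFn (μ : ℝ × ℝ) (n : ℕ) (z : ℂ) :
    (hollingTannerFamily μ).IsCharValueOfMode (coexU, coexU) n z ↔ modeFn n μ.1 μ.2 z = 0 := by
  rw [DelayedRDSystem.isCharValueOfMode_iff_det, hollingTannerFamily_charMatrix,
    Matrix.det_fin_two_of, modeFn, charFn]
  constructor <;> intro h <;> linear_combination h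

lemma isCharValue_iff_exists_modeFn (μ : ℝ × ℝ) (z : ℂ) :
    (hollingTannerFamily μ).IsCharValue (coexU, coexU) z ↔ ∃ n, modeFn n μ.1 μ.2 z = 0 := by
  simp only [DelayedRDSystem.isCharValue_iff_exists_mode (hollingTannerFamily_l_pos μ),
    isCharValueOfMode_iff_modeFn]

/-- An eigenvalue is simple when it is a simple root of the characteristic function of one mode
and not a root for any other mode. -/
lemma isSimpleCharValue_of_modeFn {μ : ℝ × ℝ} (hr : μ.2 ≠ 0) {n : ℕ} {z : ℂ}
    (h : modeFn n μ.1 μ.2 z = 0) (h' : modeFnDeriv n μ.1 μ.2 z ≠ 0)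
    (hother : ∀ m, m ≠ n → modeFn m μ.1 μ.2 z ≠ 0) :
    (hollingTannerFamily μ).IsSimpleCharValue (coexU, coexU) z := by
  unfold modeFn charFn at h
  unfold modeFnDeriv charFnDeriv at h'
  have hM := hollingTannerFamily_charMatrix μ n z
  set c : ℂ := (((n : ℝ) ^ 2 / 250 - jacUU : ℝ) : ℂ)
  set d : ℂ := ((2 * (n : ℝ) ^ 2 / 5 : ℝ) : ℂ)
  set e := Complex.exp (-z * μ.1) with he
  have hre : (μ.2 : ℂ) * e ≠ 0 := mul_ne_zero (by exact_mod_cast hr) (Complex.exp_ne_zero _)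
  refine DelayedRDSystem.isSimpleCharValue_of_mode (hollingTannerFamily_l_pos μ) (n := n)
    (v := ![z + d + μ.2 * e, μ.2 * e]) ?_ ?_ ?_ ?_ ?_
  · intro h0
    exact hre (congrFun h0 1)
  · rw [hM]
    funext i
    fin_cases i
    · simp [Matrix.mulVec, dotProduct, Fin.sum_univ_two]
      linear_combination h
    · simp [Matrix.mulVec, dotProduct, Fin.sum_univ_two]
      ring
  · intro w hw
    refine ⟨w 1 / (μ.2 * e), ?_⟩
    rw [hM] at hw
    have h1 := congrFun hw 1
    simp [Matrix.mulVec, dotProduct, Fin.sum_univ_two] at h1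
    funext i
    fin_cases i
    · simp only [Fin.zero_eta, Pi.smul_apply, Matrix.cons_val_zero, smul_eq_mul]
      rw [div_mul_eq_mul_div, eq_div_iff hre]
      linear_combination -h1
    · simp only [Fin.mk_one, Pi.smul_apply, Matrix.cons_val_one, Matrix.cons_val_fin_one,
        smul_eq_mul]
      rw [div_mul_cancel₀ _ hre]
  · exact fun m hm => by rw [isCharValueOfMode_iff_modeFn]; exact hother m hm
  · intro w hw
    have hτ : (hollingTannerFamily μ).τ = μ.1 := rfl
    rw [hM, hollingTannerFamily_B, hτ, ← he] at hw
    have h0 := congrFun hw 0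
    have h1 := congrFun hw 1
    simp only [Matrix.mulVec, dotProduct, Fin.sum_univ_two, Pi.neg_apply, Pi.add_apply,
      Pi.smul_apply, smul_eq_mul, Matrix.of_apply, Matrix.cons_val_zero, Matrix.cons_val_one,
      Matrix.cons_val_fin_one] at h0 h1
    -- pairing with the left null vector `(r e, z + c)` gives `r e` times the derivative
    have key : (μ.2 : ℂ) * e
        * (2 * z + c + d + μ.2 * e * (1 - μ.1 * (z + c + jacUV))) = 0 := by
      linear_combination ((μ.2 : ℂ) * e) * h0 + (z + c) * h1
        - (w 1 + (μ.2 : ℂ) * e * μ.1) * h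
    exact (mul_ne_zero hre h') key

/-! ### Root location near the critical parameters -/

lemma arctan_le_self {x : ℝ} (hx : 0 ≤ x) : Real.arctan x ≤ x := by
  have h := Real.le_tan (Real.arctan_nonneg.2 hx) (Real.arctan_lt_pi_div_two x)
  rwa [Real.tan_arctan] at h

lemma sub_pow_three_le_arctan {x : ℝ} (hx : 0 ≤ x) : x - x ^ 3 / 3 ≤ Real.arctan x := by
  have hd : ∀ t : ℝ, HasDerivAt (fun t => Real.arctan t - (t - t ^ 3 / 3))
      (1 / (1 + t ^ 2) - (1 - t ^ 2)) t := fun t => by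
    have := (Real.hasDerivAt_arctan t).sub
      ((hasDerivAt_id t).sub (((hasDerivAt_id t).pow 3).div_const 3))
    refine this.congr_deriv ?_
    simp only [id]
    ring
  have hm := monotone_of_deriv_nonneg (fun t => (hd t).differentiableAt) fun t => by
    rw [(hd t).deriv, sub_nonneg, le_div_iff₀ (by positivity)]
    nlinarith [sq_nonneg (t ^ 2)]
  have := hm hx
  simp only [Real.arctan_zero] at this
  linarith

lemma arctan_le_add_pow_five {x : ℝ} (hx : 0 ≤ x) :
    Real.arctan x ≤ x - x ^ 3 / 3 + x ^ 5 / 5 := by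
  have hd : ∀ t : ℝ, HasDerivAt (fun t => t - t ^ 3 / 3 + t ^ 5 / 5 - Real.arctan t)
      (1 - t ^ 2 + t ^ 4 - 1 / (1 + t ^ 2)) t := fun t => by
    have := (((hasDerivAt_id t).sub (((hasDerivAt_id t).pow 3).div_const 3)).add
      (((hasDerivAt_id t).pow 5).div_const 5)).sub (Real.hasDerivAt_arctan t)
    refine this.congr_deriv ?_
    simp only [id]
    ring
  have hm := monotone_of_deriv_nonneg (fun t => (hd t).differentiableAt) fun t => by
    rw [(hd t).deriv, sub_nonneg, div_le_iff₀ (by positivity)]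
    have : 0 ≤ t ^ 6 := by positivity
    nlinarith
  have := hm hx
  simp only [Real.arctan_zero] at this
  linarith

/-- The critical value of `r`, at which `0` is an eigenvalue of mode `5`. -/
noncomputable def critR : ℝ := (10 * jacUU - 1) / (1 / 10 + (jacUV - jacUU))

/-- A neighbourhood of the critical parameters `(τ, r)` on which the root estimates hold
uniformly. -/
def paramBox : Set (ℝ × ℝ) := Ioo 0.4566 0.4568 ×ˢ Ioo 2.8645 2.8647

lemma isOpen_paramBox : IsOpen paramBox := isOpen_Ioo.prod isOpen_Ioo

lemma critR_bounds : 2.86458 < critR ∧ critR < 2.864583 := by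
  obtain ⟨h1, h2⟩ := coexU_bounds
  have h3 : 0 < 1 / 10 + (jacUV - jacUU) := by linarith [jacUV_sub_jacUU_bounds.1]
  constructor
  · rw [critR, lt_div_iff₀ h3]
    unfold jacUV jacUU
    linarith
  · rw [critR, div_lt_iff₀ h3]
    unfold jacUV jacUU
    linarith

/-- The modulus condition for a root `iω` of `charFn`, solved by the intermediate value theorem. -/
lemma exists_modulus_eq {c d β r lo hi : ℝ} (hle : lo ≤ hi)
    (hlo : (lo ^ 2 + c ^ 2) * (lo ^ 2 + d ^ 2) ≤ r ^ 2 * (lo ^ 2 + (c + β) ^ 2))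
    (hhi : r ^ 2 * (hi ^ 2 + (c + β) ^ 2) ≤ (hi ^ 2 + c ^ 2) * (hi ^ 2 + d ^ 2)) :
    ∃ ω ∈ Icc lo hi, (ω ^ 2 + c ^ 2) * (ω ^ 2 + d ^ 2) = r ^ 2 * (ω ^ 2 + (c + β) ^ 2) := by
  have hc : ContinuousOn (fun ω : ℝ => (ω ^ 2 + c ^ 2) * (ω ^ 2 + d ^ 2)
      - r ^ 2 * (ω ^ 2 + (c + β) ^ 2)) (Icc lo hi) := by fun_prop
  obtain ⟨ω, hω, h⟩ := intermediate_value_Icc hle hc ⟨sub_nonpos.2 hlo, sub_nonneg.2 hhi⟩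
  exact ⟨ω, hω, sub_eq_zero.1 h⟩

/-- Interval version of `exists_modulus_eq`. -/
lemma exists_modulus_eq_of_bounds {c d β r lo hi c₁ c₂ s₁ s₂ r₁ r₂ : ℝ}
    (hle : lo ≤ hi) (hc₁ : 0 ≤ c₁) (hc : -c ∈ Icc c₁ c₂) (hs₁ : 0 ≤ s₁) (hs : c + β ∈ Icc s₁ s₂)
    (hr₁ : 0 ≤ r₁) (hr : r ∈ Icc r₁ r₂)
    (hlo : (lo ^ 2 + c₂ ^ 2) * (lo ^ 2 + d ^ 2) ≤ r₁ ^ 2 * (lo ^ 2 + s₁ ^ 2))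
    (hhi : r₂ ^ 2 * (hi ^ 2 + s₂ ^ 2) ≤ (hi ^ 2 + c₁ ^ 2) * (hi ^ 2 + d ^ 2)) :
    ∃ ω ∈ Icc lo hi, (ω ^ 2 + c ^ 2) * (ω ^ 2 + d ^ 2) = r ^ 2 * (ω ^ 2 + (c + β) ^ 2) := by
  have h1 : c ^ 2 ≤ c₂ ^ 2 := by rw [← neg_sq c]; exact pow_le_pow_left₀ (hc₁.trans hc.1) hc.2 2
  have h2 : c₁ ^ 2 ≤ c ^ 2 := by rw [← neg_sq c]; exact pow_le_pow_left₀ hc₁ hc.1 2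
  have h3 : s₁ ^ 2 ≤ (c + β) ^ 2 := pow_le_pow_left₀ hs₁ hs.1 2
  have h4 : (c + β) ^ 2 ≤ s₂ ^ 2 := pow_le_pow_left₀ (hs₁.trans hs.1) hs.2 2
  have h5 : r₁ ^ 2 ≤ r ^ 2 := pow_le_pow_left₀ hr₁ hr.1 2
  have h6 : r ^ 2 ≤ r₂ ^ 2 := pow_le_pow_left₀ (hr₁.trans hr.1) hr.2 2
  refine exists_modulus_eq hle ?_ ?_
  · calc _ ≤ (lo ^ 2 + c₂ ^ 2) * (lo ^ 2 + d ^ 2) := by gcongr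
      _ ≤ _ := hlo
      _ ≤ _ := by gcongr
  · calc _ ≤ r₂ ^ 2 * (hi ^ 2 + s₂ ^ 2) := by gcongr
      _ ≤ _ := hhi
      _ ≤ _ := by gcongr

lemma neg_arctan_div {c ω : ℝ} : -Real.arctan (c / ω) = Real.arctan (-c / ω) := by
  rw [neg_div, Real.arctan_neg]

/-- At the critical parameters the frequency `ω` solves the modulus condition of mode `0`, and the
delay is chosen so that the phase condition holds as well. -/
theorem exists_critical_delay_frequency :
    ∃ τ ω : ℝ, τ ∈ Ioo 0.45665 0.45675 ∧ ω ∈ Icc 2.88986 2.88993 ∧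
      (ω ^ 2 + (-jacUU) ^ 2) * (ω ^ 2 + 0 ^ 2) = critR ^ 2 * (ω ^ 2 + (-jacUU + jacUV) ^ 2) ∧
      (charLog (-jacUU) 0 jacUV τ (ω * Complex.I)).im = Real.pi := by
  obtain ⟨a1, a2⟩ := jacUU_bounds
  obtain ⟨k1, k2⟩ := jacUV_sub_jacUU_bounds
  obtain ⟨r1, r2⟩ := critR_bounds
  obtain ⟨ω, hω, hmod⟩ := exists_modulus_eq_of_bounds (c := -jacUU) (d := 0) (β := jacUV)
    (r := critR) (lo := 2.88986) (hi := 2.88993) (c₁ := 0.2625157) (c₂ := 0.2625158)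
    (s₁ := 0.467328) (s₂ := 0.4673281) (r₁ := 2.86458) (r₂ := 2.864583)
    (by norm_num) (by norm_num) ⟨by linarith, by linarith⟩ (by norm_num)
    ⟨by linarith, by linarith⟩ (by norm_num) ⟨r1.le, r2.le⟩ (by norm_num) (by norm_num)
  obtain ⟨w1, w2⟩ := hω
  have hω0 : 0 < ω := by linarith
  have ha1 : 0.090838 ≤ jacUU / ω := by rw [le_div_iff₀ hω0]; linarith
  have ha2 : jacUU / ω ≤ 0.090841 := by rw [div_le_iff₀ hω0]; linarith
  have hk1 : 0.161709 ≤ (-jacUU + jacUV) / ω := by rw [le_div_iff₀ hω0]; linarith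
  have hk2 : (-jacUU + jacUV) / ω ≤ 0.161714 := by rw [div_le_iff₀ hω0]; linarith
  -- the Taylor polynomials determine `τ` up to an error of about `10⁻⁵`, less than the distance
  -- of its value `0.45672` to the bounds
  have A1 := (sub_pow_three_le_arctan (by norm_num)).trans (Real.arctan_strictMono.monotone ha1)
  have A2 := (Real.arctan_strictMono.monotone ha2).trans (arctan_le_add_pow_five (by norm_num))
  have K1 := (sub_pow_three_le_arctan (by norm_num)).trans (Real.arctan_strictMono.monotone hk1)
  have K2 := (Real.arctan_strictMono.monotone hk2).trans (arctan_le_add_pow_five (by norm_num))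
  norm_num at A1 A2 K1 K2
  have p1 := Real.pi_gt_d6
  have p2 := Real.pi_lt_d6
  refine ⟨(Real.pi / 2 - Real.arctan (jacUU / ω) - Real.arctan ((-jacUU + jacUV) / ω)) / ω, ω,
    ⟨?_, ?_⟩, ⟨w1, w2⟩, hmod, ?_⟩
  · rw [lt_div_iff₀ hω0]; linarith
  · rw [div_lt_iff₀ hω0]; linarith
  · rw [charLog_im_mul_I hω0, div_mul_cancel₀ _ hω0.ne', neg_div, Real.arctan_neg, zero_div,
      Real.arctan_zero]
    ring

section Modes

variable {τ r : ℝ} {z : ℂ} {n : ℕ}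

lemma modeFn_eq_zero_conj (h : modeFn n τ r z = 0) :
    modeFn n τ r ((starRingEnd ℂ) z) = 0 := by
  rw [modeFn, charFn_conj, ← modeFn, h, map_zero]

lemma modeFn_zero (n : ℕ) (τ r : ℝ) : modeFn n τ r 0 = ((((n : ℝ) ^ 2 / 250 - jacUU)
    * (2 * (n : ℝ) ^ 2 / 5) + r * ((n : ℝ) ^ 2 / 250 - jacUU + jacUV) : ℝ) : ℂ) := charFn_zero ..

/-- Steady-state bifurcations occur in mode `5` only: for `k = n² / 25` the value at `0` is close to
`(k - 1) (k - 1.34)`, and `k ≤ 0.64` or `k ≥ 1.44` for the other modes. -/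
lemma modeFn_zero_pos (hμ : (τ, r) ∈ paramBox) (hn : n ≠ 5) :
    0 < ((n : ℝ) ^ 2 / 250 - jacUU) * (2 * (n : ℝ) ^ 2 / 5)
      + r * ((n : ℝ) ^ 2 / 250 - jacUU + jacUV) := by
  obtain ⟨-, hr1, hr2⟩ := hμ
  simp only at hr1 hr2
  obtain ⟨a1, a2⟩ := jacUU_bounds
  obtain ⟨k1, k2⟩ := jacUV_sub_jacUU_bounds
  set k : ℝ := (n : ℝ) ^ 2 / 25 with hk
  have hk0 : 0 ≤ k := by positivity
  have e : ((n : ℝ) ^ 2 / 250 - jacUU) * (2 * (n : ℝ) ^ 2 / 5)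
      + r * ((n : ℝ) ^ 2 / 250 - jacUU + jacUV)
      = k ^ 2 - 10 * jacUU * k + r * (k / 10 + (jacUV - jacUU)) := by rw [hk]; ring
  rw [e]
  have h1 : 2.8645 * (k / 10 + 0.467328) ≤ r * (k / 10 + (jacUV - jacUU)) := by gcongr
  have h2 : 10 * jacUU * k ≤ 2.625158 * k := by
    apply mul_le_mul_of_nonneg_right _ hk0; linarith
  rcases lt_or_gt_of_ne hn with h | h
  · have hkn : k ≤ 0.64 := by
      have : (n : ℝ) ≤ 4 := by exact_mod_cast Nat.lt_succ_iff.1 h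
      have : (n : ℝ) ^ 2 ≤ 4 ^ 2 := pow_le_pow_left₀ (by positivity) this 2
      rw [hk, div_le_iff₀ (by norm_num)]
      linarith
    have h3 : 0 ≤ (0.64 - k) * (1.7 - k) := mul_nonneg (by linarith) (by linarith)
    nlinarith only [h1, h2, h3, hk0, hkn]
  · have hkn : 1.44 ≤ k := by
      have : (6 : ℝ) ≤ n := by exact_mod_cast h
      have : (6 : ℝ) ^ 2 ≤ (n : ℝ) ^ 2 := pow_le_pow_left₀ (by positivity) this 2
      rw [hk, le_div_iff₀ (by norm_num)]
      linarith
    have h3 : 0 ≤ (k - 1.44) * (k - 0.9) := mul_nonneg (by linarith) (by linarith)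
    nlinarith only [h1, h2, h3, hk0, hkn]

lemma modeFn_five_zero_eq_zero_iff : modeFn 5 τ r 0 = 0 ↔ r = critR := by
  have h3 : (1 / 10 + (jacUV - jacUU)) ≠ 0 := by linarith [jacUV_sub_jacUU_bounds.1]
  rw [modeFn_zero, Complex.ofReal_eq_zero, critR, eq_div_iff h3]
  push_cast
  constructor <;> intro h <;> linarith

lemma modeFn_ofReal_ne_zero (hμ : (τ, r) ∈ paramBox)
    (h0 : 0 ≤ ((n : ℝ) ^ 2 / 250 - jacUU) * (2 * (n : ℝ) ^ 2 / 5)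
      + r * ((n : ℝ) ^ 2 / 250 - jacUU + jacUV)) {x : ℝ} (hx : 0 < x) :
    modeFn n τ r x ≠ 0 := by
  obtain ⟨⟨ht1, ht2⟩, hr1, hr2⟩ := hμ
  simp only at ht1 ht2 hr1 hr2
  obtain ⟨a1, a2⟩ := jacUU_bounds
  obtain ⟨b1, b2⟩ := jacUV_bounds
  have hn : (0 : ℝ) ≤ (n : ℝ) ^ 2 / 250 := by positivity
  have hrτ : r * τ ≤ 2.8647 * 0.4568 := mul_le_mul hr2.le ht2.le (by linarith) (by norm_num)
  exact charFn_ofReal_ne_zero (by positivity) (by linarith) (by linarith) (by linarith)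
    (by linarith) (by linarith) (by linarith) h0 hx

lemma im_eq_zero_of_modeFn_eq_zero (hμ : (τ, r) ∈ paramBox) (hn : 4 ≤ n) (hre : 0 ≤ z.re)
    (h : modeFn n τ r z = 0) : z.im = 0 := by
  obtain ⟨⟨ht1, ht2⟩, hr1, hr2⟩ := hμ
  simp only at ht1 ht2 hr1 hr2
  obtain ⟨b1, b2⟩ := jacUV_bounds
  have hd : 6.4 ≤ 2 * (n : ℝ) ^ 2 / 5 := by
    have : (4 : ℝ) ≤ n := by exact_mod_cast hn
    have : (4 : ℝ) ^ 2 ≤ (n : ℝ) ^ 2 := pow_le_pow_left₀ (by positivity) this 2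
    linarith
  set d := 2 * (n : ℝ) ^ 2 / 5 with hdd
  have hrb : r * jacUV ≤ 2.8647 * 0.7298438 :=
    mul_le_mul hr2.le b2.le (by linarith) (by norm_num)
  have hrb0 : 0 ≤ r * jacUV := mul_nonneg (by linarith) (by linarith)
  refine im_eq_zero_of_charFn_eq_zero (by linarith) (by linarith) (by linarith) (by linarith)
    ?_ ?_ hre h
  · calc r * jacUV * (1 + d * τ) ≤ 2.8647 * 0.7298438 * (1 + d * 0.4568) := by gcongr
      _ < (d - 2.8647) ^ 2 := by nlinarith only [hd]
      _ ≤ (d - r) ^ 2 := pow_le_pow_left₀ (by linarith) (by linarith) 2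
  · calc r * jacUV * τ ≤ 2.8647 * 0.7298438 * 0.4568 := by gcongr
      _ ≤ _ := by norm_num; linarith

/-- The phase condition in modes `1`, `2`, `3`: the phase at the frequency of the mode stays
below `π`, so these modes have no roots in the first quadrant. -/
lemma exists_modulus_eq_and_phase_lt (hμ : (τ, r) ∈ paramBox) (hn1 : 1 ≤ n) (hn3 : n ≤ 3) :
    ∃ ω : ℝ, 0 < ω ∧
      (ω ^ 2 + ((n : ℝ) ^ 2 / 250 - jacUU) ^ 2) * (ω ^ 2 + (2 * (n : ℝ) ^ 2 / 5) ^ 2)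
        = r ^ 2 * (ω ^ 2 + ((n : ℝ) ^ 2 / 250 - jacUU + jacUV) ^ 2) ∧
      (charLog ((n : ℝ) ^ 2 / 250 - jacUU) (2 * (n : ℝ) ^ 2 / 5) jacUV τ
        (ω * Complex.I)).im < Real.pi := by
  obtain ⟨⟨ht1, ht2⟩, hr1, hr2⟩ := hμ
  simp only at ht1 ht2 hr1 hr2
  obtain ⟨a1, a2⟩ := jacUU_bounds
  obtain ⟨k1, k2⟩ := jacUV_sub_jacUU_bounds
  have p1 := Real.pi_gt_d6
  -- the terms `arctan (d / ω)` and `arctan ((c + β) / ω)` cancel favourably when `c + β ≤ d`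
  have phase : ∀ {c d lo hi ω C : ℝ}, 0 < lo → ω ∈ Icc lo hi → 0 ≤ -c → -c ≤ C → c + jacUV ≤ d →
      0.4568 * hi + C / lo < 1.57079 → (charLog c d jacUV τ (ω * Complex.I)).im < Real.pi := by
    intro c d lo hi ω C hlo hω hc0 hcC hcd hnum
    have hω0 : 0 < ω := hlo.trans_le hω.1
    rw [charLog_im_mul_I hω0]
    have h1 : Real.arctan ((c + jacUV) / ω) ≤ Real.arctan (d / ω) :=
      Real.arctan_strictMono.monotone (by gcongr)
    have h2 : -Real.arctan (c / ω) ≤ -c / ω := by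
      rw [neg_arctan_div]; exact arctan_le_self (by positivity)
    have h3 : -c / ω ≤ C / lo := div_le_div₀ (hc0.trans hcC) hcC hlo hω.1
    have h4 : τ * ω ≤ 0.4568 * hi := mul_le_mul ht2.le hω.2 hω0.le (by norm_num)
    linarith
  interval_cases n
  -- for `n = 1` the term `-arctan (d / ω)` is dropped, which leaves a margin below `0.01`
  · obtain ⟨ω, hω, hmod⟩ := exists_modulus_eq_of_bounds (c := ((1 : ℕ) : ℝ) ^ 2 / 250 - jacUU)
      (d := 2 * ((1 : ℕ) : ℝ) ^ 2 / 5) (β := jacUV) (r := r) (lo := 2.86) (hi := 2.865)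
      (c₁ := 0.2585) (c₂ := 0.2586) (s₁ := 0.4713) (s₂ := 0.4714) (r₁ := 2.8645) (r₂ := 2.8647)
      (by norm_num) (by norm_num) ⟨by norm_num; linarith, by norm_num; linarith⟩
      (by norm_num) ⟨by norm_num; linarith, by norm_num; linarith⟩ (by norm_num)
      ⟨hr1.le, hr2.le⟩ (by norm_num) (by norm_num)
    have hω0 : 0 < ω := by linarith [hω.1]
    refine ⟨ω, hω0, hmod, ?_⟩
    rw [charLog_im_mul_I hω0]
    have h1 : -Real.arctan ((((1 : ℕ) : ℝ) ^ 2 / 250 - jacUU) / ω) ≤ 0.2586 / 2.86 := by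
      rw [neg_arctan_div]
      refine (arctan_le_self (div_nonneg (by norm_num; linarith) hω0.le)).trans ?_
      exact div_le_div₀ (by norm_num) (by norm_num; linarith) (by norm_num) hω.1
    have h2 : Real.arctan ((((1 : ℕ) : ℝ) ^ 2 / 250 - jacUU + jacUV) / ω) ≤ 0.4714 / 2.86 := by
      refine (arctan_le_self (div_nonneg (by norm_num; linarith) hω0.le)).trans ?_
      exact div_le_div₀ (by norm_num) (by norm_num; linarith) (by norm_num) hω.1
    have h3 : 0 ≤ Real.arctan (2 / 5 / ω) :=
      Real.arctan_nonneg.2 (by positivity)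
    have h4 : τ * ω ≤ 0.4568 * 2.865 := mul_le_mul ht2.le hω.2 hω0.le (by norm_num)
    norm_num at h1 h2 h4 ⊢
    linarith
  · obtain ⟨ω, hω, hmod⟩ := exists_modulus_eq_of_bounds (c := ((2 : ℕ) : ℝ) ^ 2 / 250 - jacUU)
      (d := 2 * ((2 : ℕ) : ℝ) ^ 2 / 5) (β := jacUV) (r := r) (lo := 2.42) (hi := 2.43)
      (c₁ := 0.2465) (c₂ := 0.2466) (s₁ := 0.4833) (s₂ := 0.4834) (r₁ := 2.8645) (r₂ := 2.8647)
      (by norm_num) (by norm_num) ⟨by norm_num; linarith, by norm_num; linarith⟩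
      (by norm_num) ⟨by norm_num; linarith, by norm_num; linarith⟩ (by norm_num)
      ⟨hr1.le, hr2.le⟩ (by norm_num) (by norm_num)
    exact ⟨ω, by linarith [hω.1], hmod, phase (C := 0.2466) (by norm_num) hω
      (by norm_num; linarith) (by norm_num; linarith) (by norm_num; linarith) (by norm_num)⟩
  · obtain ⟨ω, hω, hmod⟩ := exists_modulus_eq_of_bounds (c := ((3 : ℕ) : ℝ) ^ 2 / 250 - jacUU)
      (d := 2 * ((3 : ℕ) : ℝ) ^ 2 / 5) (β := jacUV) (r := r) (lo := 0.52) (hi := 0.54)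
      (c₁ := 0.2265) (c₂ := 0.2266) (s₁ := 0.5033) (s₂ := 0.5034) (r₁ := 2.8645) (r₂ := 2.8647)
      (by norm_num) (by norm_num) ⟨by norm_num; linarith, by norm_num; linarith⟩
      (by norm_num) ⟨by norm_num; linarith, by norm_num; linarith⟩ (by norm_num)
      ⟨hr1.le, hr2.le⟩ (by norm_num) (by norm_num)
    exact ⟨ω, by linarith [hω.1], hmod, phase (C := 0.2266) (by norm_num) hω
      (by norm_num; linarith) (by norm_num; linarith) (by norm_num; linarith) (by norm_num)⟩

/-- The case of `eq_of_charFn_eq_zero` for a mode of the linearization. -/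
lemma eq_of_modeFn_eq_zero (hμ : (τ, r) ∈ paramBox) {ω : ℝ} (hω : 0 < ω)
    (hmod : (ω ^ 2 + ((n : ℝ) ^ 2 / 250 - jacUU) ^ 2) * (ω ^ 2 + (2 * (n : ℝ) ^ 2 / 5) ^ 2)
      = r ^ 2 * (ω ^ 2 + ((n : ℝ) ^ 2 / 250 - jacUU + jacUV) ^ 2))
    (harg : (charLog ((n : ℝ) ^ 2 / 250 - jacUU) (2 * (n : ℝ) ^ 2 / 5) jacUV τ
      (ω * Complex.I)).im ≤ Real.pi)
    (hre : 0 ≤ z.re) (him : 0 < z.im) (h : modeFn n τ r z = 0) :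
    z = ω * Complex.I ∧ (charLog ((n : ℝ) ^ 2 / 250 - jacUU) (2 * (n : ℝ) ^ 2 / 5) jacUV τ
      (ω * Complex.I)).im = Real.pi := by
  obtain ⟨⟨ht1, ht2⟩, hr1, hr2⟩ := hμ
  simp only at ht1 ht2 hr1 hr2
  obtain ⟨a1, a2⟩ := jacUU_bounds
  obtain ⟨b1, b2⟩ := jacUV_bounds
  have hn : (0 : ℝ) ≤ (n : ℝ) ^ 2 / 250 := by positivity
  have hy := im_le_of_charFn_eq_zero (by linarith) (by linarith) (by linarith) hre him h
  refine eq_of_charFn_eq_zero (by linarith) (by linarith) (by linarith) (by linarith)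
    (by linarith) hω hmod harg hre him ?_ h
  calc τ * z.im ≤ 0.4568 * 3.6 := mul_le_mul ht2.le (by linarith) him.le (by norm_num)
    _ < Real.pi := by norm_num; linarith [Real.pi_gt_three]

/-- Near the critical parameters the modes other than `0` and `5` have all their eigenvalues in the
open left half-plane. -/
theorem modeFn_ne_zero_of_re_nonneg (hμ : (τ, r) ∈ paramBox) (hn0 : n ≠ 0) (hn5 : n ≠ 5)
    (hre : 0 ≤ z.re) : modeFn n τ r z ≠ 0 := by
  intro h
  have hreal : z.im = 0 := by
    rcases le_or_gt 4 n with hn | hn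
    · exact im_eq_zero_of_modeFn_eq_zero hμ hn hre h
    obtain ⟨ω, hω, hmod, harg⟩ :=
      exists_modulus_eq_and_phase_lt hμ (Nat.one_le_iff_ne_zero.2 hn0) (by omega)
    rcases lt_trichotomy z.im 0 with him | him | him
    · exact absurd (eq_of_modeFn_eq_zero hμ hω hmod harg.le (z := (starRingEnd ℂ) z) (by simpa)
        (by simpa using him) (modeFn_eq_zero_conj h)).2 harg.ne
    · exact him
    · exact absurd (eq_of_modeFn_eq_zero hμ hω hmod harg.le hre him h).2 harg.ne
  have hz : z = (z.re : ℂ) := Complex.ext rfl (by simpa using hreal)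
  have h0 := modeFn_zero_pos hμ hn5
  rcases hre.eq_or_lt with hx | hx
  · rw [hz, ← hx, Complex.ofReal_zero, modeFn_zero, Complex.ofReal_eq_zero] at h
    exact h0.ne' h
  · rw [hz] at h
    exact modeFn_ofReal_ne_zero hμ h0.le hx h

/-- The only imaginary root of mode `5` near the critical parameters is `0`, for `r = critR`. -/
lemma eq_zero_of_modeFn_five_eq_zero (hμ : (τ, r) ∈ paramBox) (hre : z.re = 0)
    (h : modeFn 5 τ r z = 0) : z = 0 ∧ r = critR := by
  have him := im_eq_zero_of_modeFn_eq_zero hμ (by norm_num) hre.ge h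
  have hz : z = 0 := Complex.ext hre him
  rw [hz] at h
  exact ⟨hz, modeFn_five_zero_eq_zero_iff.1 h⟩

/-- At `r = critR` the only root of mode `5` in the closed right half-plane is `0`. -/
lemma eq_zero_of_modeFn_five_critR_eq_zero (hμ : (τ, critR) ∈ paramBox) (hre : 0 ≤ z.re)
    (h : modeFn 5 τ critR z = 0) : z = 0 := by
  have him := im_eq_zero_of_modeFn_eq_zero hμ (by norm_num) hre h
  have hz : z = (z.re : ℂ) := Complex.ext rfl (by simpa using him)
  have h0 := modeFn_five_zero_eq_zero_iff (τ := τ).2 rfl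
  rw [modeFn_zero, Complex.ofReal_eq_zero] at h0
  rcases hre.eq_or_lt with hx | hx
  · rw [hz, ← hx, Complex.ofReal_zero]
  · rw [hz] at h
    exact absurd h (modeFn_ofReal_ne_zero hμ h0.ge hx)

/-- At the critical parameters the only roots of mode `0` in the closed right half-plane
are `± iω`. -/
lemma eq_of_modeFn_zero_eq_zero (hμ : (τ, r) ∈ paramBox) {ω : ℝ} (hω : 0 < ω)
    (hmod : (ω ^ 2 + (-jacUU) ^ 2) * (ω ^ 2 + 0 ^ 2) = r ^ 2 * (ω ^ 2 + (-jacUU + jacUV) ^ 2))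
    (harg : (charLog (-jacUU) 0 jacUV τ (ω * Complex.I)).im = Real.pi)
    (hre : 0 ≤ z.re) (h : modeFn 0 τ r z = 0) : z = ω * Complex.I ∨ z = -(ω * Complex.I) := by
  have e1 : ((0 : ℕ) : ℝ) ^ 2 / 250 - jacUU = -jacUU := by norm_num
  have e2 : 2 * ((0 : ℕ) : ℝ) ^ 2 / 5 = 0 := by norm_num
  have hmod' := hmod
  have harg' := harg.le
  rw [← e1, ← e2] at hmod' harg'
  rcases lt_trichotomy z.im 0 with him | him | him
  · right
    have := (eq_of_modeFn_eq_zero hμ hω hmod' harg' (z := (starRingEnd ℂ) z) (by simpa)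
      (by simpa using him) (modeFn_eq_zero_conj h)).1
    have h2 := congrArg (starRingEnd ℂ) this
    simpa using h2
  · exfalso
    have hz : z = (z.re : ℂ) := Complex.ext rfl (by simpa using him)
    have h0 := modeFn_zero_pos (n := 0) hμ (by norm_num)
    rcases hre.eq_or_lt with hx | hx
    · rw [hz, ← hx, Complex.ofReal_zero, modeFn_zero, Complex.ofReal_eq_zero] at h
      exact h0.ne' h
    · rw [hz] at h
      exact modeFn_ofReal_ne_zero hμ h0.le hx h
  · exact Or.inl (eq_of_modeFn_eq_zero hμ hω hmod' harg' hre him h).1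

/-- The modulus condition for an imaginary root of mode `0`. -/
lemma modulus_of_modeFn_zero_eq_zero {y : ℝ} (h : modeFn 0 τ r (y * Complex.I) = 0) :
    (y ^ 2 + jacUU ^ 2) * y ^ 2 = r ^ 2 * (y ^ 2 + (jacUV - jacUU) ^ 2) := by
  have h1 : ((y : ℂ) * Complex.I + ((-jacUU : ℝ) : ℂ)) * (y * Complex.I)
      = -(r * Complex.exp (-(y * Complex.I) * τ)
        * (y * Complex.I + ((jacUV - jacUU : ℝ) : ℂ))) := by
    have h' := h
    simp only [modeFn, charFn] at h'
    push_cast at h' ⊢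
    linear_combination h'
  have hn : ∀ a : ℝ, ‖(y : ℂ) * Complex.I + a‖ ^ 2 = y ^ 2 + a ^ 2 := fun a => by
    rw [Complex.sq_norm, Complex.normSq_apply]; simp; ring
  have h2 := congrArg (fun w : ℂ => ‖w‖ ^ 2) h1
  have he : ‖Complex.exp (-((y : ℂ) * Complex.I) * τ)‖ = 1 := by
    rw [Complex.norm_exp]; simp
  simp only [norm_neg, norm_mul, mul_pow, hn, he, Complex.norm_real, Complex.norm_I,
    Real.norm_eq_abs, sq_abs] at h2
  linarith

end Modes

/-! ### Branches of roots -/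

open Filter Topology

lemma contDiff_modeFn (n : ℕ) :
    ContDiff ℝ 1 fun p : (ℝ × ℝ) × ℂ => modeFn n p.1.1 p.1.2 p.2 := by
  have hof : ContDiff ℝ 1 (fun x : ℝ => (x : ℂ)) := Complex.ofRealCLM.contDiff
  have hτ : ContDiff ℝ 1 (fun p : (ℝ × ℝ) × ℂ => (p.1.1 : ℂ)) := hof.comp (by fun_prop)
  have hr : ContDiff ℝ 1 (fun p : (ℝ × ℝ) × ℂ => (p.1.2 : ℂ)) := hof.comp (by fun_prop)
  have hz : ContDiff ℝ 1 (fun p : (ℝ × ℝ) × ℂ => p.2) := contDiff_snd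
  unfold modeFn charFn
  exact ((hz.add contDiff_const).mul (hz.add contDiff_const)).add
    ((hr.mul ((hz.neg.mul hτ).cexp)).mul ((hz.add contDiff_const).add contDiff_const))

lemma continuous_modeFnDeriv (n : ℕ) :
    Continuous fun p : (ℝ × ℝ) × ℂ => modeFnDeriv n p.1.1 p.1.2 p.2 := by
  unfold modeFnDeriv charFnDeriv
  fun_prop

lemma hasDerivAt_modeFn (n : ℕ) (τ r : ℝ) (z : ℂ) :
    HasDerivAt (modeFn n τ r) (modeFnDeriv n τ r z) z := hasDerivAt_charFn ..

/-- A simple root of the characteristic function of a mode continues to a `C¹` branch of roots, the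
only roots near it. -/
theorem exists_root_branch {n : ℕ} {μ₀ : ℝ × ℝ} {z₀ : ℂ} (h : modeFn n μ₀.1 μ₀.2 z₀ = 0)
    (h' : modeFnDeriv n μ₀.1 μ₀.2 z₀ ≠ 0) :
    ∃ ψ : ℝ × ℝ → ℂ, ContDiffAt ℝ 1 ψ μ₀ ∧ ψ μ₀ = z₀ ∧
      ∀ᶠ p in 𝓝 (μ₀, z₀), modeFn n p.1.1 p.1.2 p.2 = 0 ↔ ψ p.1 = p.2 := by
  set Φ : (ℝ × ℝ) × ℂ → ℂ := fun p => modeFn n p.1.1 p.1.2 p.2 with hΦ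
  have hc : ContDiffAt ℝ 1 Φ (μ₀, z₀) := (contDiff_modeFn n).contDiffAt
  have hinv : (fderiv ℝ Φ (μ₀, z₀) ∘L .inr ℝ (ℝ × ℝ) ℂ).IsInvertible := by
    refine ⟨(ContinuousLinearEquiv.unitsEquivAut ℂ (Units.mk0 _ h')).restrictScalars ℝ, ?_⟩
    have h1 : HasFDerivAt (fun z => Φ (μ₀, z)) (fderiv ℝ Φ (μ₀, z₀) ∘L .inr ℝ (ℝ × ℝ) ℂ) z₀ :=
      ((hc.differentiableAt one_ne_zero).hasFDerivAt).comp z₀ (hasFDerivAt_prodMk_right μ₀ z₀)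
    have h2 : HasFDerivAt (fun z => Φ (μ₀, z)) _ z₀ :=
      ((hasDerivAt_modeFn n μ₀.1 μ₀.2 z₀).hasFDerivAt).restrictScalars ℝ
    rw [h1.unique h2]
    ext
    simp
  refine ⟨hc.implicitFunction one_ne_zero hinv, hc.contDiffAt_implicitFunction one_ne_zero hinv,
    hc.implicitFunction_apply_self one_ne_zero hinv, ?_⟩
  have h3 := hc.eventually_apply_eq_iff_implicitFunction one_ne_zero hinv
  have h4 : Φ (μ₀, z₀) = 0 := h
  rw [h4] at h3
  exact h3

/-- If `z₀` is a root for no mode other than `n`, the same holds for all nearby `z`, uniformly in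
the modes: after division by `m⁴` the characteristic functions converge as `m → ∞` to the nonzero
constant `d₁ d₂ / l⁴`. -/
lemma eventually_forall_modeFn_ne_zero {n : ℕ} {μ₀ : ℝ × ℝ} {z₀ : ℂ}
    (h : ∀ m, m ≠ n → modeFn m μ₀.1 μ₀.2 z₀ ≠ 0) :
    ∀ᶠ p in 𝓝 (μ₀, z₀), ∀ m, m ≠ n → modeFn m p.1.1 p.1.2 p.2 ≠ 0 := by
  set H : ℝ × ((ℝ × ℝ) × ℂ) → ℂ := fun q =>
    (1 / 250 + (q.2.2 - jacUU) * q.1) * (2 / 5 + q.2.2 * q.1)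
      + q.2.1.2 * Complex.exp (-q.2.2 * q.2.1.1)
        * (1 / 250 * q.1 + (q.2.2 - jacUU + jacUV) * q.1 ^ 2) with hH
  have hHc : Continuous H := by fun_prop
  have hH0 : H (0, (μ₀, z₀)) ≠ 0 := by
    simp [hH]
  have hev := hHc.continuousAt.eventually_ne hH0
  rw [nhds_prod_eq, eventually_prod_iff] at hev
  obtain ⟨pa, hpa, pb, hpb, hab⟩ := hev
  have htend : Tendsto (fun m : ℕ => ((m : ℝ) ^ 2)⁻¹) atTop (𝓝 0) :=
    tendsto_inv_atTop_zero.comp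
      ((tendsto_pow_atTop two_ne_zero).comp tendsto_natCast_atTop_atTop)
  obtain ⟨M, hM⟩ := eventually_atTop.1 (htend.eventually hpa)
  have hfin : ∀ᶠ p in 𝓝 (μ₀, z₀), ∀ m ∈ Finset.range (M + 1), m ≠ n →
      modeFn m p.1.1 p.1.2 p.2 ≠ 0 := by
    rw [eventually_all_finset]
    intro m _
    by_cases hm : m = n
    · exact Eventually.of_forall fun _ h => absurd hm h
    · have := ((contDiff_modeFn m).continuous.continuousAt (x := (μ₀, z₀))).eventually_ne (h m hm)
      filter_upwards [this] with p hp _ using hp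
  filter_upwards [hpb, hfin] with p hp hf m hmn
  rcases lt_or_ge m (M + 1) with hm | hm
  · exact hf m (Finset.mem_range.2 hm) hmn
  · have h1 := hab (hM m (by omega)) hp
    have hm0 : (m : ℂ) ≠ 0 := by
      have : m ≠ 0 := by omega
      exact_mod_cast this
    have e : modeFn m p.1.1 p.1.2 p.2 = (m : ℂ) ^ 4 * H (((m : ℝ) ^ 2)⁻¹, p) := by
      simp only [modeFn, charFn, hH]
      push_cast
      field_simp
      ring
    rw [e]
    exact mul_ne_zero (pow_ne_zero 4 hm0) h1

/-- Implicit differentiation of a branch of roots with respect to the delay. -/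
lemma hasDerivAt_branch_delay {n : ℕ} {μ₀ : ℝ × ℝ} {ψ : ℝ × ℝ → ℂ} (hψ : ContDiffAt ℝ 1 ψ μ₀)
    (h : ∀ᶠ μ in 𝓝 μ₀, modeFn n μ.1 μ.2 (ψ μ) = 0) :
    ∃ z' : ℂ, HasDerivAt (fun s => ψ (s, μ₀.2)) z' μ₀.1 ∧
      z' * modeFnDeriv n μ₀.1 μ₀.2 (ψ μ₀) = ψ μ₀ * (μ₀.2 * Complex.exp (-ψ μ₀ * μ₀.1)
        * (ψ μ₀ + (((n : ℝ) ^ 2 / 250 - jacUU : ℝ) : ℂ) + jacUV)) := by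
  have hl : HasDerivAt (fun s : ℝ => ((s, μ₀.2) : ℝ × ℝ)) ((1, 0) : ℝ × ℝ) μ₀.1 :=
    (hasDerivAt_id _).prodMk (hasDerivAt_const _ _)
  have hz := (hψ.differentiableAt one_ne_zero).hasFDerivAt.comp_hasDerivAt μ₀.1 hl
  set z' := fderiv ℝ ψ μ₀ (1, 0)
  change HasDerivAt (fun s => ψ (s, μ₀.2)) z' μ₀.1 at hz
  refine ⟨z', hz, ?_⟩
  set c : ℂ := (((n : ℝ) ^ 2 / 250 - jacUU : ℝ) : ℂ) with hc
  set d : ℂ := ((2 * (n : ℝ) ^ 2 / 5 : ℝ) : ℂ) with hd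
  have hτ : HasDerivAt (fun s : ℝ => (s : ℂ)) 1 μ₀.1 := (hasDerivAt_id μ₀.1).ofReal_comp
  have hF := ((hz.add_const c).mul (hz.add_const d)).add
    ((((hz.neg.mul hτ).cexp).const_mul (μ₀.2 : ℂ)).mul ((hz.add_const c).add_const (jacUV : ℂ)))
  have h0 : (fun s : ℝ => modeFn n s μ₀.2 (ψ (s, μ₀.2))) =ᶠ[𝓝 μ₀.1] fun _ => 0 :=
    (hl.continuousAt.tendsto).eventually h
  have h1 := (hF.congr_of_eventuallyEq (f₁ := fun _ => 0) h0.symm).unique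
    (hasDerivAt_const μ₀.1 (0 : ℂ))
  simp only [modeFnDeriv, charFnDeriv, ← hc, ← hd]
  simp only [Pi.neg_apply, Pi.mul_apply] at h1
  linear_combination h1

/-- Implicit differentiation of a branch of roots with respect to the growth rate. -/
lemma hasDerivAt_branch_rate {n : ℕ} {μ₀ : ℝ × ℝ} {ψ : ℝ × ℝ → ℂ} (hψ : ContDiffAt ℝ 1 ψ μ₀)
    (h : ∀ᶠ μ in 𝓝 μ₀, modeFn n μ.1 μ.2 (ψ μ) = 0) :
    ∃ z' : ℂ, HasDerivAt (fun s => ψ (μ₀.1, s)) z' μ₀.2 ∧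
      z' * modeFnDeriv n μ₀.1 μ₀.2 (ψ μ₀) = -(Complex.exp (-ψ μ₀ * μ₀.1)
        * (ψ μ₀ + (((n : ℝ) ^ 2 / 250 - jacUU : ℝ) : ℂ) + jacUV)) := by
  have hl : HasDerivAt (fun s : ℝ => ((μ₀.1, s) : ℝ × ℝ)) ((0, 1) : ℝ × ℝ) μ₀.2 :=
    (hasDerivAt_const _ _).prodMk (hasDerivAt_id _)
  have hz := (hψ.differentiableAt one_ne_zero).hasFDerivAt.comp_hasDerivAt μ₀.2 hl
  set z' := fderiv ℝ ψ μ₀ (0, 1)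
  change HasDerivAt (fun s => ψ (μ₀.1, s)) z' μ₀.2 at hz
  refine ⟨z', hz, ?_⟩
  set c : ℂ := (((n : ℝ) ^ 2 / 250 - jacUU : ℝ) : ℂ) with hc
  set d : ℂ := ((2 * (n : ℝ) ^ 2 / 5 : ℝ) : ℂ) with hd
  have hr : HasDerivAt (fun s : ℝ => (s : ℂ)) 1 μ₀.2 := (hasDerivAt_id μ₀.2).ofReal_comp
  have hF := ((hz.add_const c).mul (hz.add_const d)).add
    ((hr.mul ((hz.neg.mul_const (μ₀.1 : ℂ)).cexp)).mul ((hz.add_const c).add_const (jacUV : ℂ)))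
  have h0 : (fun s : ℝ => modeFn n μ₀.1 s (ψ (μ₀.1, s))) =ᶠ[𝓝 μ₀.2] fun _ => 0 :=
    (hl.continuousAt.tendsto).eventually h
  have h1 := (hF.congr_of_eventuallyEq (f₁ := fun _ => 0) h0.symm).unique
    (hasDerivAt_const μ₀.2 (0 : ℂ))
  simp only [modeFnDeriv, charFnDeriv, ← hc, ← hd]
  simp only [Pi.neg_apply, Pi.mul_apply] at h1
  linear_combination h1

/-- At a root the derivative of `charFn` is a multiple of the derivative of `charLog`. -/
lemma charFnDeriv_eq_mul_charLogDeriv {c d β τ r : ℝ} {z : ℂ} (hz : 0 < z.im)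
    (h : charFn c d β τ r z = 0) :
    charFnDeriv c d β τ r z = (z + c) * (z + d) * charLogDeriv c d β τ z := by
  have hc := add_ofReal_ne_zero_of_im_pos hz c
  have hd := add_ofReal_ne_zero_of_im_pos hz d
  have hcb := add_add_ofReal_ne_zero_of_im_pos hz c β
  have h1 : r * Complex.exp (-z * τ) = -((z + c) * (z + d)) / (z + c + β) := by
    rw [eq_div_iff hcb]
    unfold charFn at h
    linear_combination h
  rw [charFnDeriv, h1, charLogDeriv]
  field_simp
  ring

/-- An imaginary root of mode `0` near the critical parameters has frequency close to the critical
one: the modulus condition is a quadratic equation for the square of the frequency. -/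
lemma abs_sub_le_of_modulus {r r₀ y ω : ℝ} (hr : r ∈ Ioo 2.8645 2.8647) (hy : 0 < y)
    (hω : ω ∈ Icc 2.88986 2.88993)
    (h₀ : (ω ^ 2 + jacUU ^ 2) * ω ^ 2 = r₀ ^ 2 * (ω ^ 2 + (jacUV - jacUU) ^ 2))
    (h : (y ^ 2 + jacUU ^ 2) * y ^ 2 = r ^ 2 * (y ^ 2 + (jacUV - jacUU) ^ 2)) :
    |y - ω| ≤ 90 * |r ^ 2 - r₀ ^ 2| := by
  obtain ⟨k1, k2⟩ := jacUV_sub_jacUU_bounds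
  obtain ⟨w1, w2⟩ := hω
  have hw1 : (2.88986 : ℝ) ^ 2 ≤ ω ^ 2 := pow_le_pow_left₀ (by norm_num) w1 2
  have hw2 : ω ^ 2 ≤ (2.88993 : ℝ) ^ 2 := pow_le_pow_left₀ (by linarith) w2 2
  have hr2 : r ^ 2 ≤ (2.8647 : ℝ) ^ 2 := pow_le_pow_left₀ (by linarith [hr.1]) hr.2.le 2
  have hk2 : (jacUV - jacUU) ^ 2 ≤ (0.4673281 : ℝ) ^ 2 :=
    pow_le_pow_left₀ (by linarith) k2.le 2
  have hfac : 0.1 ≤ (y + ω) * (y ^ 2 + ω ^ 2 + jacUU ^ 2 - r ^ 2) := by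
    have h1 : 0.1 ≤ y ^ 2 + ω ^ 2 + jacUU ^ 2 - r ^ 2 := by
      norm_num at hw1 hr2 ⊢
      linarith [sq_nonneg y, sq_nonneg jacUU]
    calc (0.1 : ℝ) = 1 * 0.1 := by norm_num
      _ ≤ _ := mul_le_mul (by linarith) h1 (by norm_num) (by linarith)
  have key : (y - ω) * ((y + ω) * (y ^ 2 + ω ^ 2 + jacUU ^ 2 - r ^ 2))
      = (r ^ 2 - r₀ ^ 2) * (ω ^ 2 + (jacUV - jacUU) ^ 2) := by
    linear_combination h - h₀
  have h2 : |y - ω| * 0.1 ≤ |r ^ 2 - r₀ ^ 2| * 9 := by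
    calc |y - ω| * 0.1 ≤ |y - ω| * ((y + ω) * (y ^ 2 + ω ^ 2 + jacUU ^ 2 - r ^ 2)) := by gcongr
      _ = |(y - ω) * ((y + ω) * (y ^ 2 + ω ^ 2 + jacUU ^ 2 - r ^ 2))| := by
        rw [abs_mul, abs_of_nonneg (a := (y + ω) * _) (by linarith)]
      _ = |r ^ 2 - r₀ ^ 2| * (ω ^ 2 + (jacUV - jacUU) ^ 2) := by
        rw [key, abs_mul, abs_of_nonneg (a := ω ^ 2 + _) (by positivity)]
      _ ≤ |r ^ 2 - r₀ ^ 2| * 9 := by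
        gcongr
        norm_num at hw2 hk2 ⊢
        linarith
  linarith

/-! ### Transversality and the bifurcation -/

/-- A simple root of the characteristic function of one mode and of no other continues to a `C¹`
branch of such roots, unique near the given one. -/
lemma exists_simple_branch {n : ℕ} {μ₀ : ℝ × ℝ} {z₀ : ℂ} (h : modeFn n μ₀.1 μ₀.2 z₀ = 0)
    (h' : modeFnDeriv n μ₀.1 μ₀.2 z₀ ≠ 0) (hother : ∀ m, m ≠ n → modeFn m μ₀.1 μ₀.2 z₀ ≠ 0) :
    ∃ ψ : ℝ × ℝ → ℂ, ψ μ₀ = z₀ ∧ ContDiffAt ℝ 1 ψ μ₀ ∧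
      (∀ᶠ p in 𝓝 (μ₀, z₀), modeFn n p.1.1 p.1.2 p.2 = 0 → ψ p.1 = p.2) ∧
      ∀ᶠ μ in 𝓝 μ₀, ContDiffAt ℝ 1 ψ μ ∧ modeFn n μ.1 μ.2 (ψ μ) = 0 ∧
        modeFnDeriv n μ.1 μ.2 (ψ μ) ≠ 0 ∧ ∀ m, m ≠ n → modeFn m μ.1 μ.2 (ψ μ) ≠ 0 := by
  obtain ⟨ψ, hψ, hψ0, hev⟩ := exists_root_branch h h'
  refine ⟨ψ, hψ0, hψ, hev.mono fun p hp => hp.1, ?_⟩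
  have htend : Tendsto (fun μ => (μ, ψ μ)) (𝓝 μ₀) (𝓝 (μ₀, z₀)) := by
    have := tendsto_id.prodMk_nhds hψ.continuousAt.tendsto
    rwa [hψ0] at this
  have hd : ∀ᶠ p in 𝓝 (μ₀, z₀), modeFnDeriv n p.1.1 p.1.2 p.2 ≠ 0 :=
    ((continuous_modeFnDeriv n).continuousAt (x := (μ₀, z₀))).eventually_ne h'
  filter_upwards [hψ.eventually (by simp), htend.eventually hev, htend.eventually hd,
    htend.eventually (eventually_forall_modeFn_ne_zero hother)] with μ h1 h2 h3 h4
  exact ⟨h1, h2.2 rfl, h3, h4⟩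

lemma modeFnDeriv_zero_ne_zero_of_critical {τ r ω : ℝ} (hω : 0 < ω)
    (h : modeFn 0 τ r (ω * Complex.I) = 0) :
    modeFnDeriv 0 τ r (ω * Complex.I) ≠ 0 := by
  have him : 0 < ((ω : ℂ) * Complex.I).im := by simpa using hω
  obtain ⟨a1, a2⟩ := jacUU_bounds
  obtain ⟨b1, b2⟩ := jacUV_bounds
  rw [modeFnDeriv, charFnDeriv_eq_mul_charLogDeriv him h]
  refine mul_ne_zero (mul_ne_zero (add_ofReal_ne_zero_of_im_pos him _)
    (add_ofReal_ne_zero_of_im_pos him _)) fun h0 => ?_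
  have := charLogDeriv_im_neg (c := ((0 : ℕ) : ℝ) ^ 2 / 250 - jacUU)
    (d := 2 * ((0 : ℕ) : ℝ) ^ 2 / 5) (β := jacUV) (τ := τ) (by linarith)
    (by norm_num; linarith) (by simp) him
  rw [h0] at this
  exact lt_irrefl _ this

lemma modeFnDeriv_five_zero (τ r : ℝ) : modeFnDeriv 5 τ r 0
    = ((10.1 - jacUU + r * (1 - τ * (1 / 10 + (jacUV - jacUU))) : ℝ) : ℂ) := by
  simp only [modeFnDeriv, charFnDeriv]
  push_cast
  simp
  ring

lemma modeFnDeriv_five_ne_zero {τ r : ℝ} (hμ : (τ, r) ∈ paramBox) :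
    modeFnDeriv 5 τ r 0 ≠ 0 := by
  obtain ⟨⟨ht1, ht2⟩, hr1, hr2⟩ := hμ
  simp only at ht1 ht2 hr1 hr2
  obtain ⟨a1, a2⟩ := jacUU_bounds
  obtain ⟨k1, k2⟩ := jacUV_sub_jacUU_bounds
  rw [modeFnDeriv_five_zero, Complex.ofReal_ne_zero]
  have h1 : τ * (1 / 10 + (jacUV - jacUU)) ≤ 0.4568 * 1 :=
    mul_le_mul ht2.le (by linarith) (by linarith) (by norm_num)
  have h2 : 0 ≤ r * (1 - τ * (1 / 10 + (jacUV - jacUU))) :=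
    mul_nonneg (by linarith) (by linarith)
  linarith

/-- Transversality of the Hopf branch: with `z = iω`, implicit differentiation of
`charLog z = log r + iπ` gives `z' * charLogDeriv z = -z`, and `charLogDeriv z` is not real. -/
lemma deriv_re_hopf_branch_ne_zero {μ₀ : ℝ × ℝ} {ψ : ℝ × ℝ → ℂ} {ω : ℝ} (hω : 0 < ω)
    (hψ : ContDiffAt ℝ 1 ψ μ₀) (h : ∀ᶠ μ in 𝓝 μ₀, modeFn 0 μ.1 μ.2 (ψ μ) = 0)
    (hψ0 : ψ μ₀ = ω * Complex.I) : deriv (fun s => (ψ (s, μ₀.2)).re) μ₀.1 ≠ 0 := by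
  have hroot : modeFn 0 μ₀.1 μ₀.2 (ω * Complex.I) = 0 := hψ0 ▸ h.self_of_nhds
  obtain ⟨z', hz', heq⟩ := hasDerivAt_branch_delay hψ h
  have hre : HasDerivAt (fun s => (ψ (s, μ₀.2)).re) z'.re μ₀.1 :=
    Complex.reCLM.hasFDerivAt.comp_hasDerivAt μ₀.1 hz'
  rw [hre.deriv]
  have him : 0 < ((ω : ℂ) * Complex.I).im := by simpa using hω
  obtain ⟨a1, a2⟩ := jacUU_bounds
  obtain ⟨b1, b2⟩ := jacUV_bounds
  have hF := charLogDeriv_im_neg (c := ((0 : ℕ) : ℝ) ^ 2 / 250 - jacUU)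
    (d := 2 * ((0 : ℕ) : ℝ) ^ 2 / 5) (β := jacUV) (τ := μ₀.1) (by linarith)
    (by norm_num; linarith) (by simp : 0 ≤ ((ω : ℂ) * Complex.I).re) him
  rw [hψ0, modeFnDeriv, charFnDeriv_eq_mul_charLogDeriv him hroot] at heq
  have hc := add_ofReal_ne_zero_of_im_pos him (((0 : ℕ) : ℝ) ^ 2 / 250 - jacUU)
  have hd := add_ofReal_ne_zero_of_im_pos him (2 * ((0 : ℕ) : ℝ) ^ 2 / 5)
  set F := charLogDeriv (((0 : ℕ) : ℝ) ^ 2 / 250 - jacUU) (2 * ((0 : ℕ) : ℝ) ^ 2 / 5) jacUV μ₀.1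
    (ω * Complex.I)
  have key : z' * F = -(ω * Complex.I) := by
    refine mul_left_cancel₀ (mul_ne_zero hc hd) ?_
    simp only [modeFn, charFn] at hroot
    linear_combination heq + ω * Complex.I * hroot
  have hR := congrArg Complex.re key
  have hI := congrArg Complex.im key
  simp at hR hI
  intro h0
  rw [h0] at hR hI
  have : z'.im = 0 := by
    simpa [hF.ne] using hR
  rw [this] at hI
  simp at hI
  exact hω.ne' hI

/-- Transversality of the Turing branch: the characteristic function of mode `5` at `0` depends
on `r` with the nonzero slope `1 / 10 - jacUU + jacUV`. -/
lemma deriv_re_turing_branch_ne_zero {μ₀ : ℝ × ℝ} {ψ : ℝ × ℝ → ℂ}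
    (hψ : ContDiffAt ℝ 1 ψ μ₀) (h : ∀ᶠ μ in 𝓝 μ₀, modeFn 5 μ.1 μ.2 (ψ μ) = 0)
    (hψ0 : ψ μ₀ = 0) : deriv (fun s => (ψ (μ₀.1, s)).re) μ₀.2 ≠ 0 := by
  obtain ⟨z', hz', heq⟩ := hasDerivAt_branch_rate hψ h
  have hre : HasDerivAt (fun s => (ψ (μ₀.1, s)).re) z'.re μ₀.2 :=
    Complex.reCLM.hasFDerivAt.comp_hasDerivAt μ₀.2 hz'
  rw [hre.deriv]
  intro h0
  have h25 : ((5 : ℂ) ^ 2).re = 25 := by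
    rw [show (5 : ℂ) ^ 2 = ((25 : ℝ) : ℂ) by push_cast; norm_num, Complex.ofReal_re]
  have hR := congrArg Complex.re heq
  rw [hψ0, modeFnDeriv_five_zero, Complex.re_mul_ofReal, h0] at hR
  simp [h25] at hR
  linarith [jacUV_sub_jacUU_bounds.1]

/-- Near the critical parameters, an imaginary root of mode `0` in the upper half-plane lies on
the Hopf branch. -/
lemma eventually_eq_hopf_branch {r₀ τ₀ ω : ℝ} (hμ : (τ₀, r₀) ∈ paramBox)
    (hω : ω ∈ Icc 2.88986 2.88993)
    (hmod : (ω ^ 2 + jacUU ^ 2) * ω ^ 2 = r₀ ^ 2 * (ω ^ 2 + (jacUV - jacUU) ^ 2))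
    {ψ : ℝ × ℝ → ℂ} (hev : ∀ᶠ p in 𝓝 ((τ₀, r₀), (ω : ℂ) * Complex.I),
      modeFn 0 p.1.1 p.1.2 p.2 = 0 → ψ p.1 = p.2) :
    ∀ᶠ μ in 𝓝 (τ₀, r₀), ∀ y : ℝ, 0 < y → modeFn 0 μ.1 μ.2 (y * Complex.I) = 0 →
      ψ μ = y * Complex.I := by
  rw [nhds_prod_eq, eventually_prod_iff] at hev
  obtain ⟨pa, hpa, pb, hpb, hab⟩ := hev
  obtain ⟨ε, hε, hball⟩ := Metric.eventually_nhds_iff.1 hpb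
  have hsmall : ∀ᶠ μ : ℝ × ℝ in 𝓝 (τ₀, r₀), 90 * |μ.2 ^ 2 - r₀ ^ 2| < ε := by
    have hc : Continuous fun μ : ℝ × ℝ => 90 * |μ.2 ^ 2 - r₀ ^ 2| := by fun_prop
    exact hc.continuousAt.eventually_lt_const (by simpa using hε)
  filter_upwards [hpa, hsmall, isOpen_paramBox.mem_nhds hμ] with μ h1 h2 h3 y hy hroot
  have h4 := abs_sub_le_of_modulus h3.2 hy hω hmod (modulus_of_modeFn_zero_eq_zero hroot)
  refine hab h1 (hball ?_) hroot
  rw [dist_eq_norm, ← sub_mul, norm_mul, Complex.norm_I, mul_one, ← Complex.ofReal_sub,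
    Complex.norm_real]
  exact h4.trans_lt h2

/-- The four-decimal values are read as roundings: each exact constant lies within half a unit of
the last printed digit. -/
theorem mainTheorem4 :
    ∃ E : ℝ × ℝ,
      (∀ τ r : ℝ, 0 < r → ∀ E' : ℝ × ℝ,
        (0 < E'.1 ∧ 0 < E'.2 ∧ (hollingTannerFamily (τ, r)).IsSteadyState E') ↔ E' = E) ∧
      |E.1 - 0.270| ≤ 0.0005 ∧ |E.2 - 0.270| ≤ 0.0005 ∧
      ∃ τ₀ r₀ ω₀ : ℝ,
        |τ₀ - 0.4567| ≤ 0.00005 ∧ |r₀ - 2.8646| ≤ 0.00005 ∧ |ω₀ - 2.8899| ≤ 0.00005 ∧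
        ((hollingTannerFamily (τ₀, r₀)).IsCharValueOfMode E 0 (ω₀ * Complex.I) ∧
          (hollingTannerFamily (τ₀, r₀)).IsCharValueOfMode E 0 (-(ω₀ * Complex.I)) ∧
          (hollingTannerFamily (τ₀, r₀)).IsCharValueOfMode E 5 0 ∧
          (hollingTannerFamily (τ₀, r₀)).IsCharValue E (ω₀ * Complex.I) ∧
          (hollingTannerFamily (τ₀, r₀)).IsCharValue E (-(ω₀ * Complex.I)) ∧
          (hollingTannerFamily (τ₀, r₀)).IsCharValue E 0 ∧
          ∀ z : ℂ, (hollingTannerFamily (τ₀, r₀)).IsCharValue E z →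
            z ≠ ω₀ * Complex.I → z ≠ -(ω₀ * Complex.I) → z ≠ 0 → z.re < 0) ∧
        UndergoesTuringHopf hollingTannerFamily E (τ₀, r₀) ω₀ 5 := by
  obtain ⟨τ₀, ω₀, hτ₀, hω₀, hmod, harg⟩ := exists_critical_delay_frequency
  obtain ⟨u1, u2⟩ := coexU_bounds
  obtain ⟨r1, r2⟩ := critR_bounds
  have hω : 0 < ω₀ := by linarith [hω₀.1]
  have hbox : (τ₀, critR) ∈ paramBox :=
    ⟨⟨by linarith [hτ₀.1], by linarith [hτ₀.2]⟩, by linarith, by linarith⟩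
  have hmod' : (ω₀ ^ 2 + jacUU ^ 2) * ω₀ ^ 2 = critR ^ 2 * (ω₀ ^ 2 + (jacUV - jacUU) ^ 2) := by
    linear_combination hmod
  have him : 0 < ((ω₀ : ℂ) * Complex.I).im := by simpa using hω
  have hroot : modeFn 0 τ₀ critR (ω₀ * Complex.I) = 0 := by
    have h1 : charLog (-jacUU) 0 jacUV τ₀ (ω₀ * Complex.I) = Real.log critR + Real.pi * Complex.I :=
      Complex.ext (by simp [charLog_re_of_modulus (by linarith) hω hmod]) (by simp [harg])
    have h2 : charFn (-jacUU) 0 jacUV τ₀ critR (ω₀ * Complex.I) = 0 := by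
      apply charFn_eq_zero_of_exp_charLog him
      rw [h1, Complex.exp_add, Complex.exp_pi_mul_I, ← Complex.ofReal_exp,
        Real.exp_log (by linarith)]
      ring
    simpa [modeFn] using h2
  have hconj : (starRingEnd ℂ) ((ω₀ : ℂ) * Complex.I) = -(ω₀ * Complex.I) := by simp
  have hroot' : modeFn 0 τ₀ critR (-(ω₀ * Complex.I)) = 0 := hconj ▸ modeFn_eq_zero_conj hroot
  have hroot5 : modeFn 5 τ₀ critR 0 = 0 := modeFn_five_zero_eq_zero_iff.2 rfl
  refine ⟨(coexU, coexU), fun τ r hr E' => hollingTannerFamily_isSteadyState_iff hr E',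
    by rw [abs_le]; constructor <;> simp only <;> linarith,
    by rw [abs_le]; constructor <;> simp only <;> linarith,
    τ₀, critR, ω₀, by rw [abs_le]; constructor <;> linarith [hτ₀.1, hτ₀.2],
    by rw [abs_le]; constructor <;> linarith,
    by rw [abs_le]; constructor <;> linarith [hω₀.1, hω₀.2], ?_, ?_⟩
  · refine ⟨(isCharValueOfMode_iff_modeFn _ _ _).2 hroot,
      (isCharValueOfMode_iff_modeFn _ _ _).2 hroot', (isCharValueOfMode_iff_modeFn _ _ _).2 hroot5,
      (isCharValue_iff_exists_modeFn _ _).2 ⟨0, hroot⟩,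
      (isCharValue_iff_exists_modeFn _ _).2 ⟨0, hroot'⟩,
      (isCharValue_iff_exists_modeFn _ _).2 ⟨5, hroot5⟩, ?_⟩
    intro z hz h1 h2 h3
    by_contra! hre
    obtain ⟨n, hn⟩ := (isCharValue_iff_exists_modeFn _ _).1 hz
    rcases eq_or_ne n 0 with rfl | hn0
    · exact (eq_of_modeFn_zero_eq_zero hbox hω hmod harg hre hn).elim h1 h2
    rcases eq_or_ne n 5 with rfl | hn5
    · exact h3 (eq_zero_of_modeFn_five_critR_eq_zero hbox hre hn)
    exact modeFn_ne_zero_of_re_nonneg hbox hn0 hn5 hre hn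
  · -- the two branches of simple roots through `iω₀` (mode `0`) and through `0` (mode `5`)
    have hother : ∀ m, m ≠ 0 → modeFn m τ₀ critR (ω₀ * Complex.I) ≠ 0 := fun m hm h => by
      rcases eq_or_ne m 5 with rfl | hm5
      · have := (eq_zero_of_modeFn_five_eq_zero hbox (by simp) h).1
        rw [this] at him
        exact lt_irrefl _ him
      · exact modeFn_ne_zero_of_re_nonneg hbox hm hm5 (by simp) h
    have hother5 : ∀ m, m ≠ 5 → modeFn m τ₀ critR 0 ≠ 0 := fun m hm => by
      rw [modeFn_zero, Complex.ofReal_ne_zero]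
      exact (modeFn_zero_pos hbox hm).ne'
    obtain ⟨ψ, hψ0, hψ, hψu, hψev⟩ := exists_simple_branch (μ₀ := (τ₀, critR)) hroot
      (modeFnDeriv_zero_ne_zero_of_critical hω hroot) hother
    obtain ⟨χ, hχ0, hχ, hχu, hχev⟩ := exists_simple_branch (μ₀ := (τ₀, critR)) hroot5
      (modeFnDeriv_five_ne_zero hbox) hother5
    -- the Turing branch is real, as its conjugate is a branch of roots, too
    have hreal : ∀ᶠ μ in 𝓝 (τ₀, critR), χ μ = (starRingEnd ℂ) (χ μ) := by
      have htend : Tendsto (fun μ => (μ, (starRingEnd ℂ) (χ μ))) (𝓝 (τ₀, critR))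
          (𝓝 ((τ₀, critR), 0)) := by
        have := tendsto_id.prodMk_nhds
          ((Complex.continuous_conj.continuousAt.comp hχ.continuousAt).tendsto)
        simpa [hχ0] using this
      filter_upwards [htend.eventually hχu, hχev] with μ h1 h2
      exact h1 (modeFn_eq_zero_conj h2.2.1)
    have hzero : ∀ᶠ μ : ℝ × ℝ in 𝓝 (τ₀, critR), modeFn 5 μ.1 μ.2 0 = 0 → χ μ = 0 := by
      have htend : Tendsto (fun μ : ℝ × ℝ => (μ, (0 : ℂ))) (𝓝 (τ₀, critR))
          (𝓝 ((τ₀, critR), 0)) := tendsto_id.prodMk_nhds tendsto_const_nhds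
      exact htend.eventually hχu
    have hhopf := eventually_eq_hopf_branch hbox hω₀ hmod' hψu
    obtain ⟨O, hO, hOopen, hOmem⟩ := eventually_nhds_iff.1
      (hψev.and (hχev.and (hreal.and (hzero.and (hhopf.and (isOpen_paramBox.mem_nhds hbox))))))
    refine ⟨by norm_num, hω, O, hOopen, hOmem, fun μ => (ψ μ).re, fun μ => (ψ μ).im,
      fun μ => (χ μ).re,
      fun μ hμ => (Complex.reCLM.contDiff.contDiffAt.comp μ (hO μ hμ).1.1).contDiffWithinAt,
      fun μ hμ => (Complex.imCLM.contDiff.contDiffAt.comp μ (hO μ hμ).1.1).contDiffWithinAt,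
      fun μ hμ => (Complex.reCLM.contDiff.contDiffAt.comp μ (hO μ hμ).2.1.1).contDiffWithinAt,
      ?_, by simp [hψ0], by simp [hψ0], by simp [hχ0],
      deriv_re_hopf_branch_ne_zero hω hψ (hψev.mono fun μ h => h.2.1) hψ0,
      deriv_re_turing_branch_ne_zero hχ (hχev.mono fun μ h => h.2.1) hχ0⟩
    intro μ hμ
    obtain ⟨⟨-, p1, p2, p3⟩, ⟨-, q1, q2, q3⟩, hre, hz0, hy, hb⟩ := hO μ hμ
    have eψ : ((ψ μ).re : ℂ) + (ψ μ).im * Complex.I = ψ μ := Complex.re_add_im _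
    have eψ' : ((ψ μ).re : ℂ) - (ψ μ).im * Complex.I = (starRingEnd ℂ) (ψ μ) := by
      apply Complex.ext <;> simp
    have eχ : ((χ μ).re : ℂ) = χ μ := (Complex.conj_eq_iff_re.1 hre.symm)
    have hr : μ.2 ≠ 0 := by have := hb.2.1; linarith
    simp only [eψ, eψ', eχ]
    refine ⟨hollingTannerFamily_isSteadyState μ, (isCharValueOfMode_iff_modeFn _ _ _).2 p1,
      isSimpleCharValue_of_modeFn hr p1 p2 p3,
      (isCharValueOfMode_iff_modeFn _ _ _).2 (modeFn_eq_zero_conj p1),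
      isSimpleCharValue_of_modeFn hr (modeFn_eq_zero_conj p1) ?_ fun m hm h => p3 m hm ?_,
      (isCharValueOfMode_iff_modeFn _ _ _).2 q1, isSimpleCharValue_of_modeFn hr q1 q2 q3, ?_⟩
    · rw [modeFnDeriv, charFnDeriv_conj]
      exact (map_ne_zero _).2 p2
    · simpa using modeFn_eq_zero_conj h
    intro z hz h1 h2 h3 hre0
    obtain ⟨n, hn⟩ := (isCharValue_iff_exists_modeFn _ _).1 hz
    rcases eq_or_ne n 0 with rfl | hn0
    · have hzI : z = (z.im : ℂ) * Complex.I := by apply Complex.ext <;> simp [hre0]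
      rcases lt_trichotomy z.im 0 with him | him | him
      · apply h2
        have hzI' : (starRingEnd ℂ) z = ((-z.im : ℝ) : ℂ) * Complex.I := by
          apply Complex.ext <;> simp [hre0]
        have h4 := hy (-z.im) (by linarith) (hzI' ▸ modeFn_eq_zero_conj hn)
        rw [h4, ← hzI', Complex.conj_conj]
      · have hz' : z = 0 := Complex.ext hre0 him
        rw [hz', modeFn_zero, Complex.ofReal_eq_zero] at hn
        exact (modeFn_zero_pos hb (by norm_num)).ne' hn
      · apply h1
        rw [hy z.im him (hzI ▸ hn), ← hzI]
    rcases eq_or_ne n 5 with rfl | hn5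
    · have hz' := (eq_zero_of_modeFn_five_eq_zero hb hre0 hn).1
      apply h3
      rw [hz'] at hn ⊢
      exact (hz0 hn).symm
    exact modeFn_ne_zero_of_re_nonneg hb hn0 hn5 hre0.ge hn
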